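/- For a Hilbert space $H$ let $\mathbb{K}(H)$ be the C*-algebra of compact operators on $H$, and let $\bigoplus_v A_v$ denote the C*-algebraic ($c_0$-)direct sum. An $A$–$B$ correspondence is a right Hilbert $B$-module $X$ (complete, with $B$-valued inner product linear in the second variable) together with a $*$-representation of $A$ by adjointable operators on $X$ that is non-degenerate, i.e. the linear span of $A\cdot X$ is dense in $X$. Two $A$–$B$ correspondences are unitarily isomorphic ($\cong$) if there is a surjective bimodule map between them that preserves the $B$-valued inner products. The interior tensor product $X\otimes_B Y$ of an $A$–$B$ and a $B$–$C$ correspondence is the separated completion of the algebraic ($B$-balanced) tensor product for $\langle \xi\otimes\eta,\xi'\otimes\eta'\rangle=\langle\eta,\langle\xi,\xi'\rangle\eta'\rangle$, with $a(\xi\otimes\eta)c=(a\xi)\otimes(\eta c)$. For Hilbert spaces $H',H$, let $H'\otimes_{\mathbb C}H$ be the standard $\mathbb{K}(H')$–$\mathbb{K}(H)$ correspondence: the interior tensor product over $\mathbb{C}$ of $H'$, with its canonical $\mathbb{K}(H')$–$\mathbb{C}$ structure, and the $\mathbb{C}$–$\mathbb{K}(H)$ correspondence whose underlying vector space is the conjugate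 space of $H$, with $[\xi,\eta]=\theta_{\xi,\eta}=\xi\langle\eta,\cdot\rangle$ and $\xi\cdot T=T^*\xi$. Let $V,W$ be sets, $(H_v)_{v\in V}$, $(H_w)_{w\in W}$ families of non-zero complex Hilbert spaces, and $\mathsf C=(\mathsf C_{vw})$ a $V\times W$ matrix with cardinal entries. Put $E_{\mathsf C}=\{(v,\alpha,w): v\in V,\ w\in W,\ 0\le\alpha<\mathsf C_{vw}\}$ (a cardinal being identified with its initial ordinal). Then $X(\mathsf C)$ is the correspondence between $\bigoplus_v\mathbb{K}(H_v)$ and $\bigoplus_w\mathbb{K}(H_w)$ obtained as the separated completion of the space of finitely supported functions $\xi$ on $E_{\mathsf C}$ with $\xi(v,\alpha,w)\in H_v\otimes_{\mathbb C}H_w$, with respect to $$\langle\xi,\eta\rangle(w)=\sum_{(v,\alpha,w)\in E_{\mathsf C}}\langle\xi(v,\alpha,w),\eta(v,\alpha,w)\rangle_{\mathbb{K}(H_w)},\qquad (f\cdot\xi\cdot g)(v,\alpha,w)=f(v)\cdot\xi(v,\alpha,w)\cdot g(w).$$ (1) Let $\mathcal A=\bigoplus_{v\in V}\mathbb{K}(H_v)$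 and $\mathcal B=\bigoplus_{w\in W}\mathbb{K}(H_w)$. For every $\mathcal A$–$\mathcal B$ correspondence $X$ there is a unique $V\times W$ matrix $\mathsf C$ with cardinal entries such that $X\cong X(\mathsf C)$ as $\mathcal A$–$\mathcal B$ correspondences. (2) Let $U,V,W$ be sets and let $\mathcal A=\bigoplus_{u\in U}\mathbb{K}(H_u)$, $\mathcal B=\bigoplus_{v\in V}\mathbb{K}(H_v)$, $\mathcal C=\bigoplus_{w\in W}\mathbb{K}(H_w)$ for families of non-zero complex Hilbert spaces. If $\mathsf C$ and $\mathsf D$ are $U\times V$ and $V\times W$ matrices with cardinal entries, then $X(\mathsf C)\otimes_{\mathcal B}X(\mathsf D)\cong X(\mathsf C\mathsf D)$ as $\mathcal A$–$\mathcal C$ correspondences, where $(\mathsf C\mathsf D)_{uw}=\sum_{v\in V}\mathsf C_{uv}\mathsf D_{vw}$ (cardinal arithmetic). -/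

import Mathlib

universe u

noncomputable section

namespace CStarCorr

open scoped ENNReal Topology InnerProductSpace TensorProduct
open Filter

theorem isCompactOperator_adjoint {H : Type*} [NormedAddCommGroup H] [InnerProductSpace ℂ H]
    [CompleteSpace H] {T : H →L[ℂ] H} (hT : IsCompactOperator T) :
    IsCompactOperator (ContinuousLinearMap.adjoint T) := by
  set S := ContinuousLinearMap.adjoint T with hS
  have hTS : IsCompactOperator (T ∘L S) := hT.comp_clm S
  refine (isCompactOperator_iff_isCompact_closure_image_closedBall (S : H →ₗ[ℂ] H) one_pos).2 ?_
  have hc := (isCompactOperator_iff_isCompact_closure_image_closedBall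
    ((T ∘L S : H →L[ℂ] H) : H →ₗ[ℂ] H) one_pos).1 hTS
  refine TotallyBounded.isCompact_of_isClosed (TotallyBounded.closure ?_) isClosed_closure
  have ht := hc.totallyBounded.subset subset_closure
  rw [Metric.totallyBounded_iff]
  intro ε hε
  obtain ⟨t, hts, htf, ht⟩ := Metric.finite_approx_of_totallyBounded ht (ε ^ 2 / 2) (by positivity)
  have hts' : ∀ y ∈ t, ∃ g : H, g ∈ Metric.closedBall (0 : H) 1 ∧ T (S g) = y := fun y hy => hts hy
  choose! g hg1 hg2 using hts'
  refine ⟨(fun y => S (g y)) '' t, htf.image _, ?_⟩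
  rintro _ ⟨x, hx, rfl⟩
  obtain ⟨y, hy, hxy⟩ := Set.mem_iUnion₂.1 (ht ⟨x, hx, rfl⟩)
  refine Set.mem_iUnion₂.2 ⟨S (g y), ⟨y, hy, rfl⟩, ?_⟩
  have hgy := hg2 y hy
  have hgb := hg1 y hy
  rw [mem_ball_iff_norm] at hxy ⊢
  rw [← hgy] at hxy
  change ‖T (S x) - T (S (g y))‖ < _ at hxy
  change ‖S x - S (g y)‖ < _
  rw [← map_sub, ← map_sub] at hxy
  rw [← map_sub]
  have hn : ‖x - g y‖ ≤ 2 := by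
    have h1 := norm_sub_le x (g y)
    have h2 : ‖x‖ ≤ 1 := by simpa using hx
    have h3 : ‖g y‖ ≤ 1 := by simpa using hgb
    linarith
  have key : ‖S (x - g y)‖ ^ 2 ≤ ‖x - g y‖ * ‖T (S (x - g y))‖ := by
    have h1 : ‖S (x - g y)‖ ^ 2 = RCLike.re ⟪S (x - g y), S (x - g y)⟫_ℂ :=
      (inner_self_eq_norm_sq (𝕜 := ℂ) _).symm
    rw [h1]
    conv_lhs => rw [hS, ContinuousLinearMap.adjoint_inner_left, ← hS]
    exact (RCLike.re_le_norm _).trans (norm_inner_le_norm _ _)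
  have : ‖S (x - g y)‖ ^ 2 < ε ^ 2 := by
    nlinarith [norm_nonneg (x - g y), norm_nonneg (T (S (x - g y)))]
  exact lt_of_pow_lt_pow_left₀ 2 hε.le this

/-- The C⋆-algebra `𝕂(H)` of compact operators on a Hilbert space `H`. -/
def compactAlgebra (H : Type*) [NormedAddCommGroup H] [InnerProductSpace ℂ H] [CompleteSpace H] :
    NonUnitalStarSubalgebra ℂ (H →L[ℂ] H) where
  carrier := {T | IsCompactOperator T}
  add_mem' ha hb := ha.add hb
  zero_mem' := isCompactOperator_zero
  mul_mem' {_ b} ha _ := ha.comp_clm b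
  smul_mem' c _ ha := ha.smul c
  star_mem' ha := isCompactOperator_adjoint ha

instance (H : Type*) [NormedAddCommGroup H] [InnerProductSpace ℂ H] [CompleteSpace H] :
    IsClosed (compactAlgebra H : Set (H →L[ℂ] H)) :=
  isClosed_setOfPred_isCompactOperator

instance (H : Type*) [NormedAddCommGroup H] [InnerProductSpace ℂ H] [CompleteSpace H] :
    NonUnitalCStarAlgebra (compactAlgebra H) :=
  NonUnitalStarSubalgebra.nonUnitalCStarAlgebra (compactAlgebra H)

/-- The C⋆-direct sum (`c₀`-sum) `⊕ᵢ Aᵢ`. -/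
def c0Sum {ι : Type*} (A : ι → Type*) [∀ i, NonUnitalCStarAlgebra (A i)] :
    NonUnitalStarSubalgebra ℂ (lp A ∞) where
  carrier := {f | Tendsto (fun i => ‖f i‖) cofinite (𝓝 0)}
  add_mem' {a b} ha hb := by
    refine squeeze_zero (fun i => norm_nonneg _) (fun i => norm_add_le (a i) (b i)) ?_
    simpa using Tendsto.add ha hb
  zero_mem' := by simpa using tendsto_const_nhds
  mul_mem' {a b} ha hb := by
    refine squeeze_zero (fun i => norm_nonneg _) (fun i => norm_mul_le (a i) (b i)) ?_
    simpa using Tendsto.mul ha hb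
  smul_mem' c a ha := by
    refine squeeze_zero (fun i => norm_nonneg _) (fun i => norm_smul_le c (a i)) ?_
    simpa using Tendsto.const_mul ‖c‖ ha
  star_mem' {a} ha := by
    change Tendsto (fun i => ‖star (a i)‖) cofinite (𝓝 0)
    simpa using ha

instance {ι : Type*} (A : ι → Type*) [∀ i, NonUnitalCStarAlgebra (A i)] :
    IsClosed (c0Sum A : Set (lp A ∞)) := by
  refine isClosed_of_closure_subset fun f hf => ?_
  change Tendsto (fun i => ‖f i‖) cofinite (𝓝 0)
  rw [Metric.tendsto_nhds]
  intro ε hε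
  obtain ⟨g, hg, hfg⟩ := Metric.mem_closure_iff.1 hf (ε / 2) (by positivity)
  have hg' : Tendsto (fun i => ‖g i‖) cofinite (𝓝 0) := hg
  filter_upwards [(Metric.tendsto_nhds.1 hg') (ε / 2) (by positivity)] with i hi
  have h1 : ‖(f - g) i‖ ≤ ‖f - g‖ := lp.norm_apply_le_norm ENNReal.top_ne_zero (f - g) i
  have h2 : ‖f i‖ ≤ ‖(f - g) i‖ + ‖g i‖ := by
    simpa using norm_add_le ((f - g) i) (g i)
  rw [dist_eq_norm] at hfg
  simp only [dist_zero_right, norm_norm] at hi ⊢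
  linarith

instance {ι : Type*} (A : ι → Type*) [∀ i, NonUnitalCStarAlgebra (A i)] :
    NonUnitalCStarAlgebra (c0Sum A) :=
  NonUnitalStarSubalgebra.nonUnitalCStarAlgebra (c0Sum A)

/-- The inclusion of the `i`-th summand. -/
def c0Sum.ι {ι : Type*} {A : ι → Type*} [∀ i, NonUnitalCStarAlgebra (A i)] (i : ι) :
    A i →ₗ[ℂ] c0Sum A := by
  classical
  exact {
    toFun := fun a => ⟨lp.single ∞ i a, by
      refine tendsto_const_nhds.congr' ?_
      filter_upwards [(Set.finite_singleton i).compl_mem_cofinite] with j hj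
      rw [lp.single_apply_ne _ _ _ (by simpa using hj), norm_zero]⟩
    map_add' := fun a b => Subtype.ext (lp.single_add _ _ _ _)
    map_smul' := fun c a => Subtype.ext (lp.single_smul _ _ _ _) }

/-- The algebraic part of an `A`-`B` correspondence on a complex vector space `E`: a `B`-valued
semi-inner product (conjugate linear in the first variable, linear in the second), a left action
`lact a x = a · x` of `A` by maps for which `star a` acts as an adjoint of `a`, and a right action
`ract b x = x · b` of `B`. Positivity of `inner x x` is expressed by the standard
description `star c * c` of the positive elements of a C⋆-algebra. -/
structure PreCorrespondence (A B E : Type*) [NonUnitalCStarAlgebra A] [NonUnitalCStarAlgebra B]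
    [AddCommGroup E] [Module ℂ E] where
  inner : E →ₗ⋆[ℂ] E →ₗ[ℂ] B
  lact : A →ₗ[ℂ] E →ₗ[ℂ] E
  ract : B →ₗ[ℂ] E →ₗ[ℂ] E
  lact_mul : ∀ a b x, lact (a * b) x = lact a (lact b x)
  ract_mul : ∀ b c x, ract (b * c) x = ract c (ract b x)
  star_inner : ∀ x y, star (inner x y) = inner y x
  inner_ract : ∀ x b y, inner x (ract b y) = inner x y * b
  inner_lact : ∀ a x y, inner (lact a x) y = inner x (lact (star a) y)
  inner_self_pos : ∀ x, ∃ c, inner x x = star c * c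

namespace PreCorrespondence

section order

attribute [local instance] CStarAlgebra.spectralOrder CStarAlgebra.spectralOrderedRing

variable {A B E : Type*} [NonUnitalCStarAlgebra A] [NonUnitalCStarAlgebra B]
    [AddCommGroup E] [Module ℂ E] (P : PreCorrespondence A B E)

theorem inner_self_nonneg (x : E) : 0 ≤ P.inner x x := by
  obtain ⟨c, hc⟩ := P.inner_self_pos x
  rw [hc]; exact star_mul_self_nonneg c

theorem inner_ract_left (x : E) (b : B) (y : E) :
    P.inner (P.ract b x) y = star b * P.inner x y := by
  rw [← P.star_inner, P.inner_ract, star_mul, P.star_inner]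

theorem norm_inner_sq_le (x y : E) :
    ‖P.inner x y‖ ^ 2 ≤ ‖P.inner x x‖ * ‖P.inner y y‖ := by
  set a := P.inner x y with ha
  have key : ∀ t : ℝ, ‖P.inner x x‖ < t → ‖a‖ ^ 2 ≤ t * ‖P.inner y y‖ := by
    intro t ht
    have ht0 : 0 < t := (norm_nonneg _).trans_lt ht
    have h0 := P.inner_self_nonneg (P.ract a x - (t : ℂ) • y)
    have hexp : P.inner (P.ract a x - (t : ℂ) • y) (P.ract a x - (t : ℂ) • y)
        = star a * P.inner x x * a - t • (star a * a) - t • (star a * a)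
          + t • (t • P.inner y y) := by
      have hyx : P.inner y x = star a := by rw [ha, P.star_inner]
      simp only [map_sub, map_smulₛₗ, LinearMap.sub_apply, LinearMap.smul_apply, P.inner_ract,
        inner_ract_left, Complex.conj_ofReal, RingHom.id_apply, hyx, ← ha]
      simp only [Complex.coe_smul, smul_sub]
      abel
    rw [hexp] at h0
    have h1 : star a * P.inner x x * a ≤ t • (star a * a) := by
      refine (CStarAlgebra.star_left_conjugate_le_norm_smul (a := a) (b := P.inner x x)
        (hb := (P.inner_self_nonneg x).isSelfAdjoint)).trans ?_
      exact smul_le_smul_of_nonneg_right ht.le (star_mul_self_nonneg a)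
    have h2 : t • (star a * a) ≤ t • (t • P.inner y y) := by
      rw [← sub_nonneg] at h1 ⊢
      have := add_nonneg h0 h1
      convert this using 1
      abel
    have h3 : star a * a ≤ t • P.inner y y := (smul_le_smul_iff_of_pos_left ht0).1 h2
    have h4 := CStarAlgebra.norm_le_norm_of_nonneg_of_le (star_mul_self_nonneg a) h3
    rw [CStarRing.norm_star_mul_self, norm_smul, Real.norm_of_nonneg ht0.le] at h4
    nlinarith
  refine ge_of_tendsto (x := 𝓝[>] ‖P.inner x x‖)
    (f := fun t : ℝ => t * ‖P.inner y y‖) ?_ ?_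
  · exact ((continuous_id.mul continuous_const).tendsto _).mono_left nhdsWithin_le_nhds
  · filter_upwards [self_mem_nhdsWithin] with t ht using key t ht

theorem norm_inner_le (x y : E) :
    ‖P.inner x y‖ ≤ √‖P.inner x x‖ * √‖P.inner y y‖ := by
  rw [← Real.sqrt_mul (norm_nonneg _)]
  exact Real.le_sqrt_of_sq_le (P.norm_inner_sq_le x y)

theorem inner_lact_self_le (a : A) (x : E) :
    P.inner (P.lact a x) (P.lact a x) ≤ (‖a‖ ^ 2) • P.inner x x := by
  have h := CStarAlgebra.star_mul_le_algebraMap_norm_sq (a := (a : Unitization ℂ A))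
  rw [← sub_nonneg, CStarAlgebra.nonneg_iff_eq_star_mul_self] at h
  obtain ⟨c, hc⟩ := h
  set z := c.fst
  set d := c.snd
  have h1 : star z * z = ((‖a‖ ^ 2 : ℝ) : ℂ) := by
    have := congrArg (fun u : Unitization ℂ A => u.fst) hc
    simpa [sub_eq_add_neg, Unitization.norm_inr, Algebra.algebraMap_eq_smul_one] using this.symm
  have h2 : star z • d + z • star d + star d * d = - (star a * a) := by
    have := congrArg (fun u : Unitization ℂ A => u.snd) hc
    simpa [sub_eq_add_neg, Unitization.norm_inr, Algebra.algebraMap_eq_smul_one] using this.symm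
  have h3 := P.inner_self_nonneg (z • x + P.lact d x)
  have h4 : P.inner (z • x + P.lact d x) (z • x + P.lact d x) =
      (star z * z) • P.inner x x
        + P.inner x (P.lact (star z • d + z • star d + star d * d) x) := by
    simp only [map_add, map_smulₛₗ, LinearMap.add_apply, LinearMap.smul_apply, P.inner_lact,
      P.lact_mul, RingHom.id_apply, smul_add, mul_smul, starRingEnd_apply]
    rw [smul_comm z (star z)]
    abel
  rw [h4, h1, h2, map_neg, LinearMap.neg_apply, map_neg, P.lact_mul, Complex.coe_smul,
    ← sub_eq_add_neg, sub_nonneg] at h3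
  rwa [P.inner_lact]

theorem norm_inner_lact_le (a : A) (x : E) :
    √‖P.inner (P.lact a x) (P.lact a x)‖ ≤ ‖a‖ * √‖P.inner x x‖ := by
  have h := CStarAlgebra.norm_le_norm_of_nonneg_of_le (P.inner_self_nonneg _)
    (P.inner_lact_self_le a x)
  rw [norm_smul, Real.norm_of_nonneg (by positivity)] at h
  refine (Real.sqrt_le_sqrt h).trans_eq ?_
  rw [Real.sqrt_mul (by positivity), Real.sqrt_sq (norm_nonneg _)]

theorem norm_inner_ract_le (b : B) (x : E) :
    √‖P.inner (P.ract b x) (P.ract b x)‖ ≤ ‖b‖ * √‖P.inner x x‖ := by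
  have h : ‖P.inner (P.ract b x) (P.ract b x)‖ ≤ ‖b‖ ^ 2 * ‖P.inner x x‖ := by
    rw [P.inner_ract, P.inner_ract_left]
    refine (norm_mul_le _ _).trans ?_
    have := norm_mul_le (star b) (P.inner x x)
    rw [norm_star] at this
    nlinarith [norm_nonneg b]
  refine (Real.sqrt_le_sqrt h).trans_eq ?_
  rw [Real.sqrt_mul (by positivity), Real.sqrt_sq (norm_nonneg _)]

theorem norm_add_le' (x y : E) : √‖P.inner (x + y) (x + y)‖
    ≤ √‖P.inner x x‖ + √‖P.inner y y‖ := by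
  rw [Real.sqrt_le_left (by positivity)]
  have h1 := P.norm_inner_le x y
  have h2 := P.norm_inner_le y x
  have h3 := Real.sq_sqrt (norm_nonneg (P.inner x x))
  have h4 := Real.sq_sqrt (norm_nonneg (P.inner y y))
  have h5 : ‖P.inner (x + y) (x + y)‖
      ≤ ‖P.inner x x‖ + ‖P.inner y x‖ + (‖P.inner x y‖ + ‖P.inner y y‖) := by
    simp only [map_add, LinearMap.add_apply]
    exact (norm_add_le _ _).trans (add_le_add (norm_add_le _ _) (norm_add_le _ _))
  nlinarith

end order

end PreCorrespondence

/-- A (non-degenerate) `A`-`B` C⋆-correspondence: a right Hilbert `B`-module, complete in the norm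
`‖x‖ = ‖⟨x, x⟩‖ ^ (1 / 2)`, with a ⋆-representation of `A` by adjointable operators such that the
linear span of `A · X` is dense. -/
structure Correspondence (A B : Type*) [NonUnitalCStarAlgebra A] [NonUnitalCStarAlgebra B] where
  carrier : Type u
  [normedAddCommGroup : NormedAddCommGroup carrier]
  [normedSpace : NormedSpace ℂ carrier]
  [completeSpace : CompleteSpace carrier]
  pre : PreCorrespondence A B carrier
  norm_eq : ∀ x, ‖x‖ = √‖pre.inner x x‖
  nondegenerate : Dense (Submodule.span ℂ {y | ∃ a x, y = pre.lact a x} : Set carrier)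

attribute [instance] Correspondence.normedAddCommGroup Correspondence.normedSpace
  Correspondence.completeSpace

/-- `X ≅ Y`: there is a surjective bimodule map that preserves the `B`-valued inner products
(in particular it is isometric). -/
def Correspondence.Isomorphic {A B : Type*} [NonUnitalCStarAlgebra A]
    [NonUnitalCStarAlgebra B] (X Y : Correspondence A B) : Prop :=
  ∃ τ : X.carrier →ₗ[ℂ] Y.carrier, Function.Surjective τ ∧
    (∀ ξ η, Y.pre.inner (τ ξ) (τ η) = X.pre.inner ξ η) ∧
    (∀ a ξ, τ (X.pre.lact a ξ) = Y.pre.lact a (τ ξ)) ∧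
    (∀ b ξ, τ (X.pre.ract b ξ) = Y.pre.ract b (τ ξ))

namespace PreCorrespondence

variable {A B E : Type*} [NonUnitalCStarAlgebra A] [NonUnitalCStarAlgebra B]
    [AddCommGroup E] [Module ℂ E] (P : PreCorrespondence A B E)

theorem sqrt_norm_inner_smul (c : ℂ) (x : E) :
    √‖P.inner (c • x) (c • x)‖ = ‖c‖ * √‖P.inner x x‖ := by
  have : P.inner (c • x) (c • x) = (starRingEnd ℂ c * c) • P.inner x x := by
    rw [map_smul, map_smulₛₗ, LinearMap.smul_apply, smul_smul, mul_comm]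
  rw [this, norm_smul, norm_mul, RCLike.norm_conj, Real.sqrt_mul (by positivity),
    Real.sqrt_mul_self (norm_nonneg _)]

/-- The space `E` with the seminorm `‖⟨x, x⟩‖ ^ (1 / 2)`. -/
def Space (_P : PreCorrespondence A B E) : Type _ := E

instance : AddCommGroup P.Space := inferInstanceAs (AddCommGroup E)
instance : Module ℂ P.Space := inferInstanceAs (Module ℂ E)

/-- The identity map `E → P.Space`. -/
def toSpace : E ≃ₗ[ℂ] P.Space := LinearEquiv.refl ℂ E

instance : Norm P.Space := ⟨fun x => √‖P.inner (P.toSpace.symm x) (P.toSpace.symm x)‖⟩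

theorem norm_toSpace (x : E) : ‖P.toSpace x‖ = √‖P.inner x x‖ := rfl

theorem Space.core : SeminormedSpace.Core ℂ P.Space where
  norm_nonneg _ := Real.sqrt_nonneg _
  norm_smul c x := P.sqrt_norm_inner_smul c (P.toSpace.symm x)
  norm_triangle x y := P.norm_add_le' (P.toSpace.symm x) (P.toSpace.symm y)

instance : SeminormedAddCommGroup P.Space := .ofCore (Space.core P)
instance : NormedSpace ℂ P.Space where
  norm_smul_le c x := (P.sqrt_norm_inner_smul c (P.toSpace.symm x)).le

/-- The semi-inner product as a bounded sesquilinear map. -/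
def innerL : P.Space →L⋆[ℂ] P.Space →L[ℂ] B :=
  LinearMap.mkContinuous₂ (show P.Space →ₗ⋆[ℂ] P.Space →ₗ[ℂ] B from P.inner) 1 fun x y => by
    rw [one_mul]
    exact P.norm_inner_le x y

/-- The left action as bounded operators. -/
def lactL (a : A) : P.Space →L[ℂ] P.Space :=
  LinearMap.mkContinuous (show P.Space →ₗ[ℂ] P.Space from P.lact a) ‖a‖ fun x =>
    P.norm_inner_lact_le a x

/-- The right action as bounded operators. -/
def ractL (b : B) : P.Space →L[ℂ] P.Space :=
  LinearMap.mkContinuous (show P.Space →ₗ[ℂ] P.Space from P.ract b) ‖b‖ fun x =>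
    P.norm_inner_ract_le b x

/-- The separated completion of `E` in the seminorm. -/
abbrev Compl : Type _ := UniformSpace.Completion P.Space

/-- The extension of the inner product to the completion. -/
def innerC : P.Compl →L⋆[ℂ] P.Compl →L[ℂ] B :=
  P.innerL.fromCompletion.flip.fromCompletion.flip

/-- The canonical map of `E` into the separated completion. -/
def toCompl : E →ₗ[ℂ] P.Compl where
  toFun x := ((P.toSpace x : P.Space) : P.Compl)
  map_add' x y := by rw [map_add, UniformSpace.Completion.coe_add]
  map_smul' c x := by rw [map_smul, UniformSpace.Completion.coe_smul, RingHom.id_apply]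

theorem innerC_coe (x y : E) : P.innerC (P.toCompl x) (P.toCompl y) = P.inner x y := by
  simp only [innerC, toCompl, LinearMap.coe_mk, AddHom.coe_mk, ContinuousLinearMap.flip_apply,
    ContinuousLinearMap.fromCompletion_apply_coe]
  rfl

/-- The extension of the left action to the completion. -/
def lactC (a : A) : P.Compl →L[ℂ] P.Compl := (P.lactL a).completion

/-- The extension of the right action to the completion. -/
def ractC (b : B) : P.Compl →L[ℂ] P.Compl := (P.ractL b).completion

theorem lactC_coe (a : A) (x : E) : P.lactC a (P.toCompl x) = P.toCompl (P.lact a x) :=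
  ContinuousLinearMap.completion_apply_coe (P.lactL a) (P.toSpace x)

theorem ractC_coe (b : B) (x : E) : P.ractC b (P.toCompl x) = P.toCompl (P.ract b x) :=
  ContinuousLinearMap.completion_apply_coe (P.ractL b) (P.toSpace x)

theorem denseRange_toCompl : DenseRange P.toCompl :=
  UniformSpace.Completion.denseRange_coe (α := P.Space)

theorem norm_toCompl (x : E) : ‖P.toCompl x‖ = √‖P.inner x x‖ :=
  (UniformSpace.Completion.norm_coe _).trans (P.norm_toSpace x)

theorem compl_induction {p : P.Compl → Prop} (hp : IsClosed {x | p x})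
    (h : ∀ x, p (P.toCompl x)) (x : P.Compl) : p x :=
  P.denseRange_toCompl.induction_on x hp h

theorem compl_induction₂ {p : P.Compl → P.Compl → Prop}
    (h1 : ∀ x, IsClosed {y | p (P.toCompl x) y}) (h2 : ∀ y, IsClosed {x | p x y})
    (h : ∀ x y, p (P.toCompl x) (P.toCompl y)) (x y : P.Compl) : p x y :=
  P.compl_induction (h2 y) (fun x => P.compl_induction (h1 x) (h x) y) x

theorem lactC_add (a b : A) (x : P.Compl) : P.lactC (a + b) x = P.lactC a x + P.lactC b x :=
  P.compl_induction (isClosed_eq (P.lactC (a + b)).continuous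
    ((P.lactC a).continuous.add (P.lactC b).continuous))
    (fun x => by simp only [lactC_coe, map_add, LinearMap.add_apply, Pi.add_apply]) x

theorem lactC_smul (c : ℂ) (a : A) (x : P.Compl) : P.lactC (c • a) x = c • P.lactC a x :=
  P.compl_induction (isClosed_eq (P.lactC (c • a)).continuous
    ((P.lactC a).continuous.const_smul c))
    (fun x => by simp only [lactC_coe, map_smul, LinearMap.smul_apply, Pi.smul_apply]) x

theorem lactC_mul (a b : A) (x : P.Compl) : P.lactC (a * b) x = P.lactC a (P.lactC b x) :=
  P.compl_induction (isClosed_eq (P.lactC (a * b)).continuous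
    ((P.lactC a).continuous.comp (P.lactC b).continuous))
    (fun x => by simp only [lactC_coe, P.lact_mul, Function.comp_apply]) x

theorem ractC_add (a b : B) (x : P.Compl) : P.ractC (a + b) x = P.ractC a x + P.ractC b x :=
  P.compl_induction (isClosed_eq (P.ractC (a + b)).continuous
    ((P.ractC a).continuous.add (P.ractC b).continuous))
    (fun x => by simp only [ractC_coe, map_add, LinearMap.add_apply, Pi.add_apply]) x

theorem ractC_smul (c : ℂ) (a : B) (x : P.Compl) : P.ractC (c • a) x = c • P.ractC a x :=
  P.compl_induction (isClosed_eq (P.ractC (c • a)).continuous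
    ((P.ractC a).continuous.const_smul c))
    (fun x => by simp only [ractC_coe, map_smul, LinearMap.smul_apply, Pi.smul_apply]) x

theorem ractC_mul (a b : B) (x : P.Compl) : P.ractC (a * b) x = P.ractC b (P.ractC a x) :=
  P.compl_induction (isClosed_eq (P.ractC (a * b)).continuous
    ((P.ractC b).continuous.comp (P.ractC a).continuous))
    (fun x => by simp only [ractC_coe, P.ract_mul, Function.comp_apply]) x

theorem continuous_innerC_left (y : P.Compl) : Continuous fun x => P.innerC x y :=
  (P.innerC.flip y).continuous

theorem continuous_innerC_right (x : P.Compl) : Continuous fun y => P.innerC x y :=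
  (P.innerC x).continuous

theorem star_innerC (x y : P.Compl) : star (P.innerC x y) = P.innerC y x :=
  P.compl_induction₂ (p := fun x y => star (P.innerC x y) = P.innerC y x)
    (fun _ => isClosed_eq (P.continuous_innerC_right _).star (P.continuous_innerC_left _))
    (fun _ => isClosed_eq (P.continuous_innerC_left _).star (P.continuous_innerC_right _))
    (fun x y => by simp only [innerC_coe, P.star_inner]) x y

theorem innerC_ractC (x : P.Compl) (b : B) (y : P.Compl) :
    P.innerC x (P.ractC b y) = P.innerC x y * b :=
  P.compl_induction₂ (p := fun x y => P.innerC x (P.ractC b y) = P.innerC x y * b)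
    (fun _ => isClosed_eq ((P.continuous_innerC_right _).comp (P.ractC b).continuous)
      ((P.continuous_innerC_right _).mul continuous_const))
    (fun _ => isClosed_eq (P.continuous_innerC_left _)
      ((P.continuous_innerC_left _).mul continuous_const))
    (fun x y => by simp only [ractC_coe, innerC_coe, P.inner_ract]) x y

theorem innerC_lactC (a : A) (x y : P.Compl) :
    P.innerC (P.lactC a x) y = P.innerC x (P.lactC (star a) y) :=
  P.compl_induction₂ (p := fun x y => P.innerC (P.lactC a x) y = P.innerC x (P.lactC (star a) y))
    (fun _ => isClosed_eq (P.continuous_innerC_right _)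
      ((P.continuous_innerC_right _).comp (P.lactC (star a)).continuous))
    (fun _ => isClosed_eq ((P.continuous_innerC_left _).comp (P.lactC a).continuous)
      (P.continuous_innerC_left _))
    (fun x y => by simp only [lactC_coe, innerC_coe, P.inner_lact]) x y

theorem continuous_innerC_self : Continuous fun x => P.innerC x x :=
  P.innerC.continuous.clm_apply continuous_id

theorem innerC_self_pos (x : P.Compl) : ∃ c, P.innerC x x = star c * c := by
  let _ := CStarAlgebra.spectralOrder B
  have _ := CStarAlgebra.spectralOrderedRing B
  rw [← CStarAlgebra.nonneg_iff_eq_star_mul_self]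
  refine P.compl_induction (p := fun x => 0 ≤ P.innerC x x)
    (isClosed_le continuous_const P.continuous_innerC_self) ?_ x
  intro x
  rw [innerC_coe]
  exact P.inner_self_nonneg x

/-- The inner product and the actions on the separated completion. -/
def preCompletion : PreCorrespondence A B P.Compl where
  inner := LinearMap.mk₂'ₛₗ (starRingEnd ℂ) (RingHom.id ℂ) (fun x y => P.innerC x y)
    (fun x y z => by rw [map_add, _root_.add_apply])
    (fun c x y => by rw [map_smulₛₗ, _root_.smul_apply])
    (fun x y z => map_add _ _ _) (fun c x y => map_smul _ _ _)
  lact := LinearMap.mk₂ ℂ (fun a x => P.lactC a x) P.lactC_add P.lactC_smul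
    (fun _ _ _ => map_add _ _ _) (fun _ _ _ => map_smul _ _ _)
  ract := LinearMap.mk₂ ℂ (fun b x => P.ractC b x) P.ractC_add P.ractC_smul
    (fun _ _ _ => map_add _ _ _) (fun _ _ _ => map_smul _ _ _)
  lact_mul := P.lactC_mul
  ract_mul := P.ractC_mul
  star_inner := P.star_innerC
  inner_ract := P.innerC_ractC
  inner_lact := P.innerC_lactC
  inner_self_pos := P.innerC_self_pos

/-- The separated completion of a semi-inner product bimodule, as a correspondence. -/
def completion {E : Type u} [AddCommGroup E] [Module ℂ E] (P : PreCorrespondence A B E)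
    (h : Dense (Submodule.span ℂ {y | ∃ a x, y = P.toSpace (P.lact a x)} : Set P.Space)) :
    Correspondence.{u} A B where
  carrier := P.Compl
  pre := P.preCompletion
  norm_eq x := by
    refine P.compl_induction (p := fun x => ‖x‖ = √‖P.innerC x x‖)
      (isClosed_eq continuous_norm P.continuous_innerC_self.norm.sqrt) ?_ x
    intro x
    rw [innerC_coe, norm_toCompl]
  nondegenerate := by
    rw [dense_iff_closure_eq, Set.eq_univ_iff_forall]
    intro x
    rw [← Submodule.topologicalClosure_coe]
    refine P.compl_induction (Submodule.isClosed_topologicalClosure _) ?_ x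
    intro x
    have hx := h (P.toSpace x)
    have := map_mem_closure (UniformSpace.Completion.continuous_coe P.Space) hx
      (t := (Submodule.span ℂ {y | ∃ a x, y = P.preCompletion.lact a x} : Set P.Compl)) ?_
    · exact this
    · intro y hy
      have h2 : P.toCompl (P.toSpace.symm y) ∈
          Submodule.span ℂ {y | ∃ a x, y = P.preCompletion.lact a x} := by
        refine Submodule.span_induction (p := fun y _ => P.toCompl (P.toSpace.symm y) ∈
          Submodule.span ℂ {y | ∃ a x, y = P.preCompletion.lact a x}) ?_ ?_ ?_ ?_ hy
        · rintro _ ⟨a, x, rfl⟩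
          refine Submodule.subset_span ⟨a, P.toCompl x, ?_⟩
          exact (P.lactC_coe a x).symm
        · rw [map_zero, map_zero]; exact Submodule.zero_mem _
        · intro x y _ _ hx hy
          rw [map_add, map_add]; exact Submodule.add_mem _ hx hy
        · intro c x _ hx
          rw [map_smul, map_smul]; exact Submodule.smul_mem _ _ hx
      exact h2

end PreCorrespondence

section positivity

attribute [local instance] CStarAlgebra.spectralOrder CStarAlgebra.spectralOrderedRing

theorem exists_posPart_negPart {D : Type*} [NonUnitalCStarAlgebra D] (a : D)
    (ha : star a = a) : ∃ p n : D, a = star p * p - star n * n ∧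
      star n * n * (star p * p) = 0 := by
  obtain ⟨p, hp⟩ := CStarAlgebra.nonneg_iff_eq_star_mul_self.1 (CFC.posPart_nonneg a)
  obtain ⟨n, hn⟩ := CStarAlgebra.nonneg_iff_eq_star_mul_self.1 (CFC.negPart_nonneg a)
  refine ⟨p, n, ?_, ?_⟩
  · rw [← hp, ← hn, CFC.posPart_sub_negPart a ha]
  · rw [← hp, ← hn, CFC.negPart_mul_posPart a]

theorem exists_matrix_star_mul_self {n B : Type*} [Fintype n] [NonUnitalCStarAlgebra B]
    (M : n → n → B) (hM : ∀ i j, star (M i j) = M j i)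
    (hpos : ∀ v : n → B, 0 ≤ ∑ i, ∑ j, star (v i) * M i j * v j) :
    ∃ S : n → n → B, ∀ i j, M i j = ∑ k, star (S k i) * S k j := by
  let M' : CStarMatrix n n B := CStarMatrix.ofMatrix (Matrix.of M)
  have hsa : IsSelfAdjoint M' := by
    ext i j
    exact hM j i
  obtain ⟨S, R, hSR, hRS⟩ := exists_posPart_negPart M' hsa
  obtain ⟨N, hR⟩ : ∃ N, N = star R * R := ⟨_, rfl⟩
  rw [← hR] at hSR hRS
  have hNs : star N = N := by rw [hR, star_mul, star_star]
  set T := R * N with hT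
  have hTT : star T * T = N * N * N := by
    rw [hT, star_mul, hNs, mul_assoc, ← mul_assoc (star R), ← hR, ← mul_assoc]
  have hMN : star N * M' * N = -(N * N * N) := by
    rw [hNs]
    rw [hSR, mul_sub, hRS, zero_sub, neg_mul]
  have hTz : T = 0 := by
    ext i k
    have h1 : (star T * T) k k = ∑ i, star (T i k) * T i k := rfl
    have h2 : (star N * M' * N) k k = ∑ i, ∑ j, star (N i k) * M i j * N j k := by
      rw [Finset.sum_comm]
      change ∑ j, (∑ i, star (N i k) * M i j) * N j k = _
      simp_rw [Finset.sum_mul]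
    have h3 : ∑ i, star (T i k) * T i k ≤ 0 := by
      rw [← h1, hTT, ← neg_nonneg]
      have := hpos (fun i => N i k)
      rw [← h2, hMN] at this
      exact this
    have h4 : ∑ i, star (T i k) * T i k = 0 :=
      le_antisymm h3 (Finset.sum_nonneg fun i _ => star_mul_self_nonneg _)
    have h5 := (Finset.sum_eq_zero_iff_of_nonneg
      (fun i _ => star_mul_self_nonneg (T i k))).1 h4 i (Finset.mem_univ i)
    exact CStarRing.star_mul_self_eq_zero_iff _ |>.1 h5
  have hN3 : N * N * N = 0 := by rw [← hTT, hTz, mul_zero]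
  have hN2 : N * N = 0 := by
    rw [← CStarRing.star_mul_self_eq_zero_iff, star_mul, hNs, ← mul_assoc, hN3, zero_mul]
  have hN1 : N = 0 := by
    rw [← CStarRing.star_mul_self_eq_zero_iff, hNs, hN2]
  have hS : M' = star S * S := by rw [hSR, hN1, sub_zero]
  refine ⟨S, fun i j => ?_⟩
  have : M' i j = (star S * S) i j := by rw [hS]
  exact this

theorem sum_inner_gram_nonneg {n A B C E F : Type*} [Fintype n] [NonUnitalCStarAlgebra A]
    [NonUnitalCStarAlgebra B] [NonUnitalCStarAlgebra C] [AddCommGroup E] [Module ℂ E]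
    [AddCommGroup F] [Module ℂ F] (P : PreCorrespondence A B E) (Q : PreCorrespondence B C F)
    (ξ : n → E) (η : n → F) :
    0 ≤ ∑ i, ∑ j, Q.inner (η i) (Q.lact (P.inner (ξ i) (ξ j)) (η j)) := by
  obtain ⟨S, hS⟩ := exists_matrix_star_mul_self (fun i j => P.inner (ξ i) (ξ j))
    (fun i j => P.star_inner _ _) (fun v => by
      have h := P.inner_self_nonneg (∑ i, P.ract (v i) (ξ i))
      simp only [map_sum, LinearMap.sum_apply, P.inner_ract, P.inner_ract_left] at h
      rw [Finset.sum_comm] at h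
      exact h)
  have : ∑ i, ∑ j, Q.inner (η i) (Q.lact (P.inner (ξ i) (ξ j)) (η j)) =
      ∑ k, Q.inner (∑ i, Q.lact (S k i) (η i)) (∑ j, Q.lact (S k j) (η j)) := by
    have h1 : ∀ k, Q.inner (∑ i, Q.lact (S k i) (η i)) (∑ j, Q.lact (S k j) (η j)) =
        ∑ i, ∑ j, Q.inner (η i) (Q.lact (star (S k i) * S k j) (η j)) := by
      intro k
      simp only [map_sum, LinearMap.sum_apply, Q.lact_mul, Q.inner_lact]
      exact Finset.sum_comm
    rw [Finset.sum_congr rfl fun k _ => h1 k]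
    refine Eq.trans ?_ Finset.sum_comm
    refine Finset.sum_congr rfl fun i _ => ?_
    refine Eq.trans ?_ Finset.sum_comm
    refine Finset.sum_congr rfl fun j _ => ?_
    rw [hS i j, map_sum, LinearMap.sum_apply, map_sum]
  rw [this]
  exact Finset.sum_nonneg fun k _ => Q.inner_self_nonneg _

end positivity

namespace PreCorrespondence

variable {A B C E F : Type*} [NonUnitalCStarAlgebra A] [NonUnitalCStarAlgebra B]
  [NonUnitalCStarAlgebra C] [AddCommGroup E] [Module ℂ E] [AddCommGroup F] [Module ℂ F]
  (P : PreCorrespondence A B E) (Q : PreCorrespondence B C F)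

/-- The linear functional `ξ' ⊗ η' ↦ ⟨η, ⟨ξ, ξ'⟩ η'⟩`. -/
def tensorInnerAux (ξ : E) (η : F) : E ⊗[ℂ] F →ₗ[ℂ] C :=
  TensorProduct.lift (LinearMap.mk₂ ℂ (fun ξ' η' => Q.inner η (Q.lact (P.inner ξ ξ') η'))
    (fun _ _ _ => by simp only [map_add, LinearMap.add_apply])
    (fun _ _ _ => by simp only [map_smul, LinearMap.smul_apply])
    (fun _ _ _ => by simp only [map_add])
    (fun _ _ _ => by simp only [map_smul]))

theorem tensorInnerAux_tmul (ξ ξ' : E) (η η' : F) :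
    P.tensorInnerAux Q ξ η (ξ' ⊗ₜ η') = Q.inner η (Q.lact (P.inner ξ ξ') η') := rfl

/-- `⟨ξ ⊗ η, ξ' ⊗ η'⟩ = ⟨η, ⟨ξ, ξ'⟩ η'⟩`. -/
def tensorInner : E ⊗[ℂ] F →ₗ⋆[ℂ] E ⊗[ℂ] F →ₗ[ℂ] C :=
  TensorProduct.lift (LinearMap.mk₂'ₛₗ (starRingEnd ℂ) (starRingEnd ℂ)
    (fun ξ η => P.tensorInnerAux Q ξ η)
    (fun _ _ _ => TensorProduct.ext' fun _ _ => by
      simp only [tensorInnerAux_tmul, map_add, LinearMap.add_apply])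
    (fun _ _ _ => TensorProduct.ext' fun _ _ => by
      simp only [tensorInnerAux_tmul, map_smulₛₗ, RingHom.id_apply, LinearMap.smul_apply])
    (fun _ _ _ => TensorProduct.ext' fun _ _ => by
      simp only [tensorInnerAux_tmul, map_add, LinearMap.add_apply])
    (fun _ _ _ => TensorProduct.ext' fun _ _ => by
      simp only [tensorInnerAux_tmul, map_smulₛₗ, LinearMap.smul_apply]))

theorem tensorInner_tmul (ξ ξ' : E) (η η' : F) :
    P.tensorInner Q (ξ ⊗ₜ η) (ξ' ⊗ₜ η') = Q.inner η (Q.lact (P.inner ξ ξ') η') := rfl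

theorem tensor_induction₂ {p : E ⊗[ℂ] F → E ⊗[ℂ] F → Prop}
    (h0 : ∀ y, p 0 y) (h0' : ∀ x, p x 0)
    (h1 : ∀ x x' y, p x y → p x' y → p (x + x') y)
    (h2 : ∀ x y y', p x y → p x y' → p x (y + y'))
    (h : ∀ ξ η ξ' η', p (ξ ⊗ₜ η) (ξ' ⊗ₜ η')) (x y : E ⊗[ℂ] F) : p x y := by
  induction x with
  | zero => exact h0 y
  | add x x' hx hx' => exact h1 _ _ _ hx hx'
  | tmul ξ η =>
    induction y with
    | zero => exact h0' _
    | add y y' hy hy' => exact h2 _ _ _ hy hy'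
    | tmul ξ' η' => exact h _ _ _ _

/-- The algebraic tensor product with `⟨ξ ⊗ η, ξ' ⊗ η'⟩ = ⟨η, ⟨ξ, ξ'⟩ η'⟩`,
`a · (ξ ⊗ η) = (a · ξ) ⊗ η` and `(ξ ⊗ η) · c = ξ ⊗ (η · c)`. -/
def tensor : PreCorrespondence A C (E ⊗[ℂ] F) where
  inner := P.tensorInner Q
  lact := (LinearMap.rTensorHom F).comp P.lact
  ract := (LinearMap.lTensorHom E).comp Q.ract
  lact_mul a b x := by
    induction x with
    | zero => simp only [map_zero]
    | add x y hx hy => simp only [map_add, hx, hy]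
    | tmul ξ η =>
      simp only [LinearMap.comp_apply, LinearMap.coe_rTensorHom, LinearMap.rTensor_tmul,
        P.lact_mul]
  ract_mul a b x := by
    induction x with
    | zero => simp only [map_zero]
    | add x y hx hy => simp only [map_add, hx, hy]
    | tmul ξ η =>
      simp only [LinearMap.comp_apply, LinearMap.coe_lTensorHom, LinearMap.lTensor_tmul,
        Q.ract_mul]
  star_inner x y := by
    refine tensor_induction₂ (p := fun x y => star (P.tensorInner Q x y) = P.tensorInner Q y x)
      ?_ ?_ ?_ ?_ ?_ x y
    · simp
    · simp
    · intro x x' y h h'; simp only [map_add, LinearMap.add_apply, star_add, h, h']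
    · intro x y y' h h'; simp only [map_add, LinearMap.add_apply, star_add, h, h']
    · intro ξ η ξ' η'
      rw [tensorInner_tmul, tensorInner_tmul, Q.star_inner, Q.inner_lact, P.star_inner]
  inner_ract x c y := by
    refine tensor_induction₂ (p := fun x y => P.tensorInner Q x
      (((LinearMap.lTensorHom E).comp Q.ract) c y) = P.tensorInner Q x y * c) ?_ ?_ ?_ ?_ ?_ x y
    · simp
    · simp
    · intro x x' y h h'; simp only [map_add, LinearMap.add_apply, add_mul, h, h']
    · intro x y y' h h'; simp only [map_add, add_mul, h, h']
    · intro ξ η ξ' η'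
      simp only [LinearMap.comp_apply, LinearMap.coe_lTensorHom, LinearMap.lTensor_tmul,
        tensorInner_tmul]
      rw [← star_star (P.inner ξ ξ'), ← Q.inner_lact, Q.inner_ract, Q.inner_lact]
  inner_lact a x y := by
    refine tensor_induction₂ (p := fun x y => P.tensorInner Q
      (((LinearMap.rTensorHom F).comp P.lact) a x) y = P.tensorInner Q x
      (((LinearMap.rTensorHom F).comp P.lact) (star a) y)) ?_ ?_ ?_ ?_ ?_ x y
    · simp
    · simp
    · intro x x' y h h'; simp only [map_add, LinearMap.add_apply, h, h']
    · intro x y y' h h'; simp only [map_add, h, h']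
    · intro ξ η ξ' η'
      simp only [LinearMap.comp_apply, LinearMap.coe_rTensorHom, LinearMap.rTensor_tmul,
        tensorInner_tmul, P.inner_lact]
  inner_self_pos x := by
    let _ := CStarAlgebra.spectralOrder C
    have _ := CStarAlgebra.spectralOrderedRing C
    rw [← CStarAlgebra.nonneg_iff_eq_star_mul_self]
    obtain ⟨s, rfl⟩ := TensorProduct.exists_finset x
    have h := sum_inner_gram_nonneg P Q (fun i : s => i.1.1) (fun i : s => i.1.2)
    rw [← Finset.sum_coe_sort s]
    simp only [map_sum, LinearMap.sum_apply, tensorInner_tmul]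
    rw [Finset.sum_comm]
    exact h

theorem tensor_inner_tmul (ξ ξ' : E) (η η' : F) :
    (P.tensor Q).inner (ξ ⊗ₜ η) (ξ' ⊗ₜ η') = Q.inner η (Q.lact (P.inner ξ ξ') η') := rfl

theorem tensor_lact_tmul (a : A) (ξ : E) (η : F) :
    (P.tensor Q).lact a (ξ ⊗ₜ η) = P.lact a ξ ⊗ₜ η := rfl

theorem tensor_ract_tmul (c : C) (ξ : E) (η : F) :
    (P.tensor Q).ract c (ξ ⊗ₜ η) = ξ ⊗ₜ Q.ract c η := rfl

end PreCorrespondence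

namespace Correspondence

variable {A B C : Type*} [NonUnitalCStarAlgebra A] [NonUnitalCStarAlgebra B]
  [NonUnitalCStarAlgebra C]

theorem norm_toSpace_tmul_le (X : Correspondence A B) (Y : Correspondence B C)
    (ξ : X.carrier) (η : Y.carrier) :
    ‖(X.pre.tensor Y.pre).toSpace (ξ ⊗ₜ η)‖ ≤ ‖ξ‖ * ‖η‖ := by
  rw [PreCorrespondence.norm_toSpace, PreCorrespondence.tensor_inner_tmul,
    Real.sqrt_le_left (by positivity)]
  have h1 := Y.pre.norm_inner_le η (Y.pre.lact (X.pre.inner ξ ξ) η)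
  have h2 := Y.pre.norm_inner_lact_le (X.pre.inner ξ ξ) η
  simp only [← Y.norm_eq] at h1 h2
  have h3 : ‖X.pre.inner ξ ξ‖ = ‖ξ‖ ^ 2 := by
    rw [X.norm_eq, Real.sq_sqrt (norm_nonneg _)]
  rw [h3] at h2
  calc _ ≤ _ := h1
    _ ≤ ‖η‖ * (‖ξ‖ ^ 2 * ‖η‖) := by gcongr
    _ = _ := by ring

/-- The interior tensor product `X ⊗_B Y`: the separated completion of the algebraic tensor
product. The elements `ξ b ⊗ η - ξ ⊗ b η` are null vectors of the semi-inner product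
(see `tmul_balanced`), so the separated completion identifies them with `0`. -/
def tensor (X : Correspondence.{u} A B) (Y : Correspondence.{u} B C) :
    Correspondence.{u} A C :=
  (X.pre.tensor Y.pre).completion (by
    set Z := X.pre.tensor Y.pre
    rw [dense_iff_closure_eq, Set.eq_univ_iff_forall]
    intro x
    rw [← Submodule.topologicalClosure_coe]
    obtain ⟨x, rfl⟩ := Z.toSpace.surjective x
    induction x with
    | zero => rw [map_zero]; exact Submodule.zero_mem _
    | add x y hx hy => rw [map_add]; exact Submodule.add_mem _ hx hy
    | tmul ξ η =>
      let f : X.carrier →L[ℂ] Z.Space :=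
        LinearMap.mkContinuous (Z.toSpace.toLinearMap.comp
          ((TensorProduct.mk ℂ X.carrier Y.carrier).flip η)) ‖η‖ fun ξ => by
            rw [mul_comm]
            exact norm_toSpace_tmul_le X Y ξ η
      change f ξ ∈ closure _
      refine map_mem_closure f.continuous (X.nondegenerate ξ) fun y hy => ?_
      refine Submodule.span_induction (p := fun y _ => f y ∈
        Submodule.span ℂ {y | ∃ a x, y = Z.toSpace (Z.lact a x)}) ?_ ?_ ?_ ?_ hy
      · rintro _ ⟨a, x, rfl⟩
        exact Submodule.subset_span ⟨a, x ⊗ₜ η, rfl⟩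
      · rw [map_zero]; exact Submodule.zero_mem _
      · intro x y _ _ hx hy
        rw [map_add]; exact Submodule.add_mem _ hx hy
      · intro c x _ hx
        rw [map_smul]; exact Submodule.smul_mem _ _ hx)

/-- The elementary tensor `ξ ⊗ η` in `X ⊗_B Y`. -/
def tmul (X : Correspondence.{u} A B) (Y : Correspondence.{u} B C) (ξ : X.carrier)
    (η : Y.carrier) : (X.tensor Y).carrier :=
  (X.pre.tensor Y.pre).toCompl (ξ ⊗ₜ η)

end Correspondence

namespace PreCorrespondence
variable {A B E : Type*} [NonUnitalCStarAlgebra A] [NonUnitalCStarAlgebra B]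
    [AddCommGroup E] [Module ℂ E] (P : PreCorrespondence A B E)

theorem toCompl_eq_zero (x : E) (h : P.inner x x = 0) : P.toCompl x = 0 := by
  rw [← norm_eq_zero, norm_toCompl, h, norm_zero, Real.sqrt_zero]
end PreCorrespondence

theorem Correspondence.tmul_balanced {A B C : Type*} [NonUnitalCStarAlgebra A]
    [NonUnitalCStarAlgebra B] [NonUnitalCStarAlgebra C] (X : Correspondence.{u} A B)
    (Y : Correspondence.{u} B C) (ξ : X.carrier) (b : B) (η : Y.carrier) :
    X.tmul Y (X.pre.ract b ξ) η = X.tmul Y ξ (Y.pre.lact b η) := by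
  refine sub_eq_zero.1 (((X.pre.tensor Y.pre).toCompl.map_sub _ _).symm.trans ?_)
  refine PreCorrespondence.toCompl_eq_zero _ _ ?_
  simp only [map_sub, LinearMap.sub_apply, PreCorrespondence.tensor_inner_tmul,
    X.pre.inner_ract, X.pre.inner_ract_left, Y.pre.lact_mul, Y.pre.inner_lact]
  simp

theorem exists_sum_eq_star_mul_self {D I : Type*} [NonUnitalCStarAlgebra D] (t : Finset I)
    (f : I → D) (hf : ∀ i ∈ t, ∃ c, f i = star c * c) : ∃ c, ∑ i ∈ t, f i = star c * c := by
  let _ := CStarAlgebra.spectralOrder D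
  have _ := CStarAlgebra.spectralOrderedRing D
  simp only [← CStarAlgebra.nonneg_iff_eq_star_mul_self] at hf ⊢
  exact Finset.sum_nonneg hf

section c0

variable {ι : Type*} {A : ι → Type*} [∀ i, NonUnitalCStarAlgebra (A i)]

/-- The coordinate `f ↦ f(i)`. -/
def c0Sum.eval (i : ι) : c0Sum A →ₗ[ℂ] A i where
  toFun f := f.1 i
  map_add' _ _ := rfl
  map_smul' _ _ := rfl

theorem c0Sum.eval_mul (i : ι) (f g : c0Sum A) :
    c0Sum.eval i (f * g) = c0Sum.eval i f * c0Sum.eval i g := rfl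

theorem c0Sum.eval_star (i : ι) (f : c0Sum A) :
    c0Sum.eval i (star f) = star (c0Sum.eval i f) := rfl

@[ext]
theorem c0Sum.ext {f g : c0Sum A} (h : ∀ i, c0Sum.eval i f = c0Sum.eval i g) : f = g :=
  Subtype.ext (lp.ext (funext h))

theorem c0Sum.eval_ι_self (i : ι) (a : A i) : c0Sum.eval i (c0Sum.ι i a) = a := by
  classical
  exact lp.single_apply_self ∞ i a

theorem c0Sum.eval_ι_ne {i j : ι} (h : j ≠ i) (a : A i) :
    c0Sum.eval j (c0Sum.ι i a) = 0 := by
  classical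
  exact lp.single_apply_ne ∞ i a h

theorem c0Sum.ι_mul (i : ι) (a : A i) (f : c0Sum A) :
    c0Sum.ι i a * f = c0Sum.ι i (a * c0Sum.eval i f) := by
  ext j
  by_cases h : j = i
  · subst h; rw [c0Sum.eval_mul, c0Sum.eval_ι_self, c0Sum.eval_ι_self]
  · rw [c0Sum.eval_mul, c0Sum.eval_ι_ne h, c0Sum.eval_ι_ne h, zero_mul]

theorem c0Sum.star_ι (i : ι) (a : A i) : star (c0Sum.ι i a) = c0Sum.ι i (star a) := by
  ext j
  by_cases h : j = i
  · subst h; rw [c0Sum.eval_star, c0Sum.eval_ι_self, c0Sum.eval_ι_self]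
  · rw [c0Sum.eval_star, c0Sum.eval_ι_ne h, c0Sum.eval_ι_ne h, star_zero]

theorem c0Sum.norm_ι (i : ι) (a : A i) : ‖c0Sum.ι i a‖ = ‖a‖ := by
  classical
  exact lp.norm_single (p := ∞) (by simp) i a

end c0

section directSum

variable {V W I : Type*} {A : V → Type*} {B : W → Type*} [∀ v, NonUnitalCStarAlgebra (A v)]
  [∀ w, NonUnitalCStarAlgebra (B w)] (s : I → V) (r : I → W)
  (F : ∀ e, Correspondence.{u} (A (s e)) (B (r e)))

/-- `⟨ξ, η⟩(w) = ∑ ⟨ξ(e), η(e)⟩`, the sum over all `e` with `r e = w`; both functions are finitely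
supported. -/
def sumInner (ξ η : Π₀ e, (F e).carrier) : c0Sum B :=
  ∑ᶠ e, c0Sum.ι (r e) ((F e).pre.inner (ξ e) (η e))

open Classical in
theorem sumInner_eq (ξ η : Π₀ e, (F e).carrier) (t : Finset I)
    (ht : ξ.support ⊆ t ∨ η.support ⊆ t) :
    sumInner s r F ξ η = ∑ e ∈ t, c0Sum.ι (r e) ((F e).pre.inner (ξ e) (η e)) := by
  refine finsum_eq_sum_of_support_subset _ fun e he => ?_
  by_contra hne
  refine he ?_
  rcases ht with ht | ht
  · have : ξ e = 0 := by
      by_contra h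
      exact hne (ht (DFinsupp.mem_support_iff.2 h))
    simp only [this, map_zero, LinearMap.zero_apply]
  · have : η e = 0 := by
      by_contra h
      exact hne (ht (DFinsupp.mem_support_iff.2 h))
    simp only [this, map_zero]

/-- Finitely supported functions `ξ` on `I` with values `ξ(e)` in `A_{s(e)}`-`B_{r(e)}`
correspondences `F e`, with `(f · ξ · g)(e) = f(s e) · ξ(e) · g(r e)`. -/
def sumPre : PreCorrespondence (c0Sum A) (c0Sum B) (Π₀ e, (F e).carrier) where
  inner := LinearMap.mk₂'ₛₗ (starRingEnd ℂ) (RingHom.id ℂ) (sumInner s r F)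
    (fun ξ ξ' η => by
      classical
      rw [sumInner_eq s r F _ η η.support (Or.inr subset_rfl),
        sumInner_eq s r F _ η η.support (Or.inr subset_rfl),
        sumInner_eq s r F _ η η.support (Or.inr subset_rfl)]
      simp only [DFinsupp.add_apply, map_add, LinearMap.add_apply, Finset.sum_add_distrib])
    (fun c ξ η => by
      classical
      rw [sumInner_eq s r F _ η η.support (Or.inr subset_rfl),
        sumInner_eq s r F _ η η.support (Or.inr subset_rfl)]
      simp only [DFinsupp.smul_apply, map_smulₛₗ, RingHom.id_apply, LinearMap.smul_apply,
        Finset.smul_sum])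
    (fun ξ η η' => by
      classical
      rw [sumInner_eq s r F ξ _ ξ.support (Or.inl subset_rfl),
        sumInner_eq s r F ξ _ ξ.support (Or.inl subset_rfl),
        sumInner_eq s r F ξ _ ξ.support (Or.inl subset_rfl)]
      simp only [DFinsupp.add_apply, map_add, Finset.sum_add_distrib])
    (fun c ξ η => by
      classical
      rw [sumInner_eq s r F ξ _ ξ.support (Or.inl subset_rfl),
        sumInner_eq s r F ξ _ ξ.support (Or.inl subset_rfl)]
      simp only [DFinsupp.smul_apply, map_smulₛₗ, RingHom.id_apply, Finset.smul_sum])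
  lact := LinearMap.mk₂ ℂ
    (fun f ξ => DFinsupp.mapRange (fun e x => (F e).pre.lact (c0Sum.eval (s e) f) x)
      (fun _ => map_zero _) ξ)
    (fun _ _ _ => DFinsupp.ext fun _ => by
      simp only [DFinsupp.mapRange_apply, DFinsupp.add_apply, map_add, LinearMap.add_apply])
    (fun _ _ _ => DFinsupp.ext fun _ => by
      simp only [DFinsupp.mapRange_apply, DFinsupp.smul_apply, map_smul, LinearMap.smul_apply])
    (fun _ _ _ => DFinsupp.ext fun _ => by
      simp only [DFinsupp.mapRange_apply, DFinsupp.add_apply, map_add])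
    (fun _ _ _ => DFinsupp.ext fun _ => by
      simp only [DFinsupp.mapRange_apply, DFinsupp.smul_apply, map_smul])
  ract := LinearMap.mk₂ ℂ
    (fun g ξ => DFinsupp.mapRange (fun e x => (F e).pre.ract (c0Sum.eval (r e) g) x)
      (fun _ => map_zero _) ξ)
    (fun _ _ _ => DFinsupp.ext fun _ => by
      simp only [DFinsupp.mapRange_apply, DFinsupp.add_apply, map_add, LinearMap.add_apply])
    (fun _ _ _ => DFinsupp.ext fun _ => by
      simp only [DFinsupp.mapRange_apply, DFinsupp.smul_apply, map_smul, LinearMap.smul_apply])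
    (fun _ _ _ => DFinsupp.ext fun _ => by
      simp only [DFinsupp.mapRange_apply, DFinsupp.add_apply, map_add])
    (fun _ _ _ => DFinsupp.ext fun _ => by
      simp only [DFinsupp.mapRange_apply, DFinsupp.smul_apply, map_smul])
  lact_mul a b ξ := DFinsupp.ext fun e => by
    simp only [LinearMap.mk₂_apply, DFinsupp.mapRange_apply, c0Sum.eval_mul, (F e).pre.lact_mul]
  ract_mul a b ξ := DFinsupp.ext fun e => by
    simp only [LinearMap.mk₂_apply, DFinsupp.mapRange_apply, c0Sum.eval_mul, (F e).pre.ract_mul]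
  star_inner ξ η := by
    classical
    simp only [LinearMap.mk₂'ₛₗ_apply]
    rw [sumInner_eq s r F ξ η ξ.support (Or.inl subset_rfl),
      sumInner_eq s r F η ξ ξ.support (Or.inr subset_rfl), star_sum]
    exact Finset.sum_congr rfl fun e _ => by rw [c0Sum.star_ι, (F e).pre.star_inner]
  inner_ract ξ g η := by
    classical
    simp only [LinearMap.mk₂'ₛₗ_apply, LinearMap.mk₂_apply]
    rw [sumInner_eq s r F ξ _ ξ.support (Or.inl subset_rfl),
      sumInner_eq s r F ξ η ξ.support (Or.inl subset_rfl), Finset.sum_mul]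
    exact Finset.sum_congr rfl fun e _ => by
      rw [c0Sum.ι_mul, DFinsupp.mapRange_apply, (F e).pre.inner_ract]
  inner_lact f ξ η := by
    classical
    simp only [LinearMap.mk₂'ₛₗ_apply, LinearMap.mk₂_apply]
    rw [sumInner_eq s r F _ η η.support (Or.inr subset_rfl),
      sumInner_eq s r F ξ _ (η.support) (Or.inr (DFinsupp.support_mapRange))]
    exact Finset.sum_congr rfl fun e _ => by
      rw [DFinsupp.mapRange_apply, DFinsupp.mapRange_apply, (F e).pre.inner_lact,
        c0Sum.eval_star]
  inner_self_pos ξ := by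
    classical
    simp only [LinearMap.mk₂'ₛₗ_apply]
    rw [sumInner_eq s r F ξ ξ ξ.support (Or.inl subset_rfl)]
    refine exists_sum_eq_star_mul_self _ _ fun e _ => ?_
    obtain ⟨c, hc⟩ := (F e).pre.inner_self_pos (ξ e)
    have : c0Sum.ι (r e) ((F e).pre.inner (ξ e) (ξ e)) =
        star (c0Sum.ι (r e) c) * c0Sum.ι (r e) c := by
      rw [hc, c0Sum.star_ι, c0Sum.ι_mul, c0Sum.eval_ι_self]
    exact ⟨_, this⟩

theorem sumPre_inner (ξ η : Π₀ e, (F e).carrier) :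
    (sumPre s r F).inner ξ η = ∑ᶠ e, c0Sum.ι (r e) ((F e).pre.inner (ξ e) (η e)) := rfl

theorem sumPre_lact_apply (f : c0Sum A) (ξ : Π₀ e, (F e).carrier) (e : I) :
    (sumPre s r F).lact f ξ e = (F e).pre.lact (c0Sum.eval (s e) f) (ξ e) := rfl

theorem sumPre_ract_apply (g : c0Sum B) (ξ : Π₀ e, (F e).carrier) (e : I) :
    (sumPre s r F).ract g ξ e = (F e).pre.ract (c0Sum.eval (r e) g) (ξ e) := rfl

open Classical in
theorem norm_toSpace_single_le (e : I) (y : (F e).carrier) :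
    ‖(sumPre s r F).toSpace (DFinsupp.single e y)‖ ≤ ‖y‖ := by
  rw [PreCorrespondence.norm_toSpace, (F e).norm_eq]
  refine Real.sqrt_le_sqrt ?_
  change ‖sumInner s r F _ _‖ ≤ _
  rw [sumInner_eq s r F _ _ {e} (Or.inl DFinsupp.support_single_subset),
    Finset.sum_singleton, c0Sum.norm_ι, DFinsupp.single_eq_same]

open Classical in
theorem sumPre_nondegenerate : Dense (Submodule.span ℂ {y | ∃ a x, y =
    (sumPre s r F).toSpace ((sumPre s r F).lact a x)} : Set (sumPre s r F).Space) := by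
  set P := sumPre s r F
  rw [dense_iff_closure_eq, Set.eq_univ_iff_forall]
  intro x
  rw [← Submodule.topologicalClosure_coe]
  obtain ⟨x, rfl⟩ := P.toSpace.surjective x
  induction x using DFinsupp.induction with
  | h0 => rw [map_zero]; exact Submodule.zero_mem _
  | ha e y x _ _ hx =>
    rw [map_add]
    refine Submodule.add_mem _ ?_ hx
    let f : (F e).carrier →L[ℂ] P.Space :=
      LinearMap.mkContinuous
        { toFun := fun y => P.toSpace (DFinsupp.single e y)
          map_add' := fun x y => by rw [DFinsupp.single_add, map_add]
          map_smul' := fun c y => by rw [DFinsupp.single_smul, map_smul, RingHom.id_apply] } 1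
        fun y => by
          rw [one_mul]
          exact norm_toSpace_single_le s r F e y
    change f y ∈ closure _
    refine map_mem_closure f.continuous ((F e).nondegenerate y) fun y hy => ?_
    refine Submodule.span_induction (p := fun y _ => f y ∈
      Submodule.span ℂ {y | ∃ a x, y = P.toSpace (P.lact a x)}) ?_ ?_ ?_ ?_ hy
    · rintro _ ⟨a, x, rfl⟩
      refine Submodule.subset_span ⟨c0Sum.ι (s e) a, DFinsupp.single e x, ?_⟩
      change P.toSpace (DFinsupp.single e _) = _
      congr 1
      refine DFinsupp.ext fun e' => ?_
      rw [sumPre_lact_apply]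
      by_cases h : e' = e
      · subst h
        rw [DFinsupp.single_eq_same, DFinsupp.single_eq_same,
          c0Sum.eval_ι_self]
      · rw [DFinsupp.single_eq_of_ne h, DFinsupp.single_eq_of_ne h,
          map_zero]
    · rw [map_zero]; exact Submodule.zero_mem _
    · intro x y _ _ hx hy
      rw [map_add]; exact Submodule.add_mem _ hx hy
    · intro c x _ hx
      rw [map_smul]; exact Submodule.smul_mem _ _ hx

/-- The correspondence over `⊕_v A_v` and `⊕_w B_w` obtained by completing the finitely supported
functions. -/
def sumCorr {I : Type u} (s : I → V) (r : I → W)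
    (F : ∀ e, Correspondence.{u} (A (s e)) (B (r e))) :
    Correspondence.{u} (c0Sum A) (c0Sum B) :=
  (sumPre s r F).completion (sumPre_nondegenerate s r F)

end directSum

section std

/-- The conjugate Hilbert space: `H` as a set, with scalar multiplication `c • x = conj c x`. -/
def ConjSpace (H : Type*) : Type _ := H

variable (H : Type*) [NormedAddCommGroup H] [InnerProductSpace ℂ H]

instance : NormedAddCommGroup (ConjSpace H) := inferInstanceAs (NormedAddCommGroup H)

instance : Module ℂ (ConjSpace H) := Module.compHom H (starRingEnd ℂ)

instance : NormedSpace ℂ (ConjSpace H) where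
  norm_smul_le c x := by
    refine (norm_smul_le (starRingEnd ℂ c) (show H from x)).trans_eq ?_
    rw [RCLike.norm_conj]
    rfl

instance [CompleteSpace H] : CompleteSpace (ConjSpace H) := inferInstanceAs (CompleteSpace H)

/-- The identity map `H → ConjSpace H`, which is conjugate linear. -/
def toConj : H ≃ₗ⋆[ℂ] ConjSpace H where
  toFun x := x
  invFun x := x
  map_add' _ _ := rfl
  map_smul' c x := by
    change c • x = (starRingEnd ℂ (starRingEnd ℂ c)) • x
    rw [Complex.conj_conj]
  left_inv _ := rfl
  right_inv _ := rfl


theorem toConj_symm_smul (c : ℂ) (x : ConjSpace H) :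
    (toConj H).symm (c • x) = starRingEnd ℂ c • (toConj H).symm x := rfl

theorem toConj_star_smul (c : ℂ) (x : H) :
    toConj H (star c • x) = c • toConj H x := by
  rw [map_smulₛₗ, ← starRingEnd_apply, Complex.conj_conj]

variable {H} in
theorem isCompactOperator_rankOne [CompleteSpace H] (x y : H) :
    IsCompactOperator (InnerProductSpace.rankOne ℂ x y) := by
  rw [InnerProductSpace.rankOne_def']
  exact (isCompactOperator_of_locallyCompactSpace_dom (innerSL ℂ y)).clm_comp
    (.toSpanSingleton ℂ x)

/-- The rank-one operator `θ_{x,y}(z) = x ⟨y, z⟩`. -/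
def theta [CompleteSpace H] (x y : H) : compactAlgebra H :=
  ⟨InnerProductSpace.rankOne ℂ x y, isCompactOperator_rankOne x y⟩

theorem theta_self_pos [CompleteSpace H] (x : H) :
    ∃ c : compactAlgebra H, theta H x x = star c * c := by
  refine ⟨(‖x‖ : ℂ)⁻¹ • theta H x x, Subtype.ext ?_⟩
  change InnerProductSpace.rankOne ℂ x x =
    ContinuousLinearMap.adjoint ((‖x‖ : ℂ)⁻¹ • InnerProductSpace.rankOne ℂ x x) ∘L
      ((‖x‖ : ℂ)⁻¹ • InnerProductSpace.rankOne ℂ x x)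
  by_cases hx : x = 0
  · simp [hx]
  · have h0 : (‖x‖ : ℂ) ≠ 0 := by simpa using hx
    rw [map_smulₛₗ, InnerProductSpace.adjoint_rankOne, ContinuousLinearMap.smul_comp,
      ContinuousLinearMap.comp_smul, InnerProductSpace.rankOne_comp_rankOne,
      inner_self_eq_norm_sq_to_K, smul_smul, smul_smul, map_inv₀, Complex.conj_ofReal]
    have : (‖x‖ : ℂ)⁻¹ * (‖x‖ : ℂ)⁻¹ * (‖x‖ : ℂ) ^ 2 = 1 := by field_simp
    erw [this]
    rw [one_smul]

/-- A Hilbert space `H` as a `𝕂(H)`-`ℂ` correspondence. -/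
def stdLeft (H : Type u) [NormedAddCommGroup H] [InnerProductSpace ℂ H] [CompleteSpace H] :
    Correspondence.{u} (compactAlgebra H) ℂ where
  carrier := H
  pre :=
    { inner := innerₛₗ ℂ
      lact := LinearMap.mk₂ ℂ (fun T x => T.1 x) (fun _ _ _ => rfl) (fun _ _ _ => rfl)
        (fun _ _ _ => map_add _ _ _) (fun _ _ _ => map_smul _ _ _)
      ract := LinearMap.lsmul ℂ H
      lact_mul := fun _ _ _ => rfl
      ract_mul := fun b c x => by
        simp only [LinearMap.lsmul_apply]
        rw [mul_comm, mul_smul]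
      star_inner := fun x y => inner_conj_symm y x
      inner_ract := fun x b y => by
        simp only [LinearMap.lsmul_apply, innerₛₗ_apply_apply, inner_smul_right]
        exact mul_comm _ _
      inner_lact := fun T x y => by
        simp only [LinearMap.mk₂_apply, innerₛₗ_apply_apply]
        exact (ContinuousLinearMap.adjoint_inner_right T.1 x y).symm
      inner_self_pos := fun x => ⟨(‖x‖ : ℂ), by
        simp only [innerₛₗ_apply_apply, inner_self_eq_norm_sq_to_K]
        simp [sq]⟩ }
  norm_eq x := by
    simp only [innerₛₗ_apply_apply]
    rw [inner_self_eq_norm_sq_to_K]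
    simp
  nondegenerate := by
    refine dense_univ.mono fun x _ => ?_
    by_cases hx : x = 0
    · rw [hx]; exact Submodule.zero_mem _
    · have : x = ((‖x‖ : ℂ) ^ 2)⁻¹ • ((theta H x x).1 x) := by
        rw [theta, InnerProductSpace.rankOne_apply, inner_self_eq_norm_sq_to_K, smul_smul]
        have : (‖x‖ : ℂ) ≠ 0 := by simpa using hx
        simp [this]
      rw [this]
      exact Submodule.smul_mem _ _ (Submodule.subset_span ⟨theta H x x, x, rfl⟩)

/-- The standard `ℂ`-`𝕂(H)` correspondence: the set `H` with inner product `[x, y] = θ_{x,y}` and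
right action `x · T = T⋆ x`, so `x · θ_{y,z} = θ_{z,y}(x)`. As `θ_{x,y}` is conjugate
linear in `y`, the complex vector space underlying this right module is the conjugate of `H`. -/
def stdRight (H : Type u) [NormedAddCommGroup H] [InnerProductSpace ℂ H] [CompleteSpace H] :
    Correspondence.{u} ℂ (compactAlgebra H) where
  carrier := ConjSpace H
  pre :=
    { inner := LinearMap.mk₂'ₛₗ (starRingEnd ℂ) (RingHom.id ℂ)
        (fun x y => theta H ((toConj H).symm x) ((toConj H).symm y))
        (fun _ _ _ => Subtype.ext (by simp [theta]))
        (fun _ _ _ => Subtype.ext (by simp [theta, toConj_symm_smul]))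
        (fun _ _ _ => Subtype.ext (by simp [theta]))
        (fun _ _ _ => Subtype.ext (by simp [theta, toConj_symm_smul]))
      lact := LinearMap.lsmul ℂ (ConjSpace H)
      ract := LinearMap.mk₂ ℂ
        (fun T x => toConj H (star T.1 ((toConj H).symm x)))
        (fun _ _ _ => by
          rw [← map_add (toConj H)]
          exact congrArg (toConj H) (by
            simp only [NonUnitalStarSubalgebra.coe_add, star_add, _root_.add_apply]))
        (fun _ _ _ => by
          rw [← toConj_star_smul]
          exact congrArg (toConj H) (by
            simp only [NonUnitalStarSubalgebra.coe_smul, star_smul, _root_.smul_apply]))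
        (fun _ _ _ => by simp only [map_add])
        (fun _ _ _ => by rw [toConj_symm_smul, map_smul, starRingEnd_apply, toConj_star_smul])
      lact_mul := fun a b x => mul_smul a b x
      ract_mul := fun b c x => by
        simp only [LinearMap.mk₂_apply, NonUnitalStarSubalgebra.coe_mul, star_mul]
        rfl
      star_inner := fun x y => Subtype.ext (InnerProductSpace.adjoint_rankOne _ _)
      inner_ract := fun x T y => by
        refine Subtype.ext (ContinuousLinearMap.ext fun z => ?_)
        change InnerProductSpace.rankOne ℂ _ (ContinuousLinearMap.adjoint T.1 _) z =
          InnerProductSpace.rankOne ℂ _ _ (T.1 z)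
        rw [InnerProductSpace.rankOne_apply, InnerProductSpace.rankOne_apply]
        exact congrArg (· • _) (ContinuousLinearMap.adjoint_inner_left _ _ _)
      inner_lact := fun a x y => by
        refine Subtype.ext ?_
        simp [theta]
      inner_self_pos := fun x => theta_self_pos H ((toConj H).symm x) }
  norm_eq x := by
    change _ = √‖InnerProductSpace.rankOne ℂ ((toConj H).symm x) ((toConj H).symm x)‖
    rw [InnerProductSpace.norm_rankOne, Real.sqrt_mul_self (norm_nonneg _)]
    rfl
  nondegenerate := by
    refine dense_univ.mono fun x _ => Submodule.subset_span ⟨1, x, ?_⟩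
    simp

end std

theorem stdRight_inner (H : Type u) [NormedAddCommGroup H] [InnerProductSpace ℂ H]
    [CompleteSpace H] (x y : H) :
    (stdRight H).pre.inner (toConj H x) (toConj H y) = theta H x y := rfl

theorem stdRight_ract_theta (H : Type u) [NormedAddCommGroup H] [InnerProductSpace ℂ H]
    [CompleteSpace H] (x y z : H) :
    (stdRight H).pre.ract (theta H y z) (toConj H x) = toConj H ((theta H z y).1 x) :=
  congrArg (fun T : H →L[ℂ] H => toConj H (T x)) (InnerProductSpace.adjoint_rankOne y z)

/-- The standard `𝕂(H')`-`𝕂(H)` correspondence `H' ⊗_ℂ H` (interior tensor product over `ℂ`). -/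
def stdBimodule (H' H : Type u) [NormedAddCommGroup H'] [InnerProductSpace ℂ H'] [CompleteSpace H']
    [NormedAddCommGroup H] [InnerProductSpace ℂ H] [CompleteSpace H] :
    Correspondence.{u} (compactAlgebra H') (compactAlgebra H) :=
  (stdLeft H').tensor (stdRight H)

/-- `E_C = {(v, α, w) | 0 ≤ α < C v w}`, a cardinal being identified with its initial ordinal. -/
structure Edge {V W : Type u} (C : Matrix V W Cardinal.{u}) : Type u where
  src : V
  tgt : W
  idx : (C src tgt).ord.ToType

/-- The C⋆-algebra `⊕_v 𝕂(H_v)`. -/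
abbrev compactSum {V : Type*} (H : V → Type*) [∀ v, NormedAddCommGroup (H v)]
    [∀ v, InnerProductSpace ℂ (H v)] [∀ v, CompleteSpace (H v)] :=
  c0Sum (fun v => compactAlgebra (H v))

/-- The correspondence `X(C)` over `⊕_v 𝕂(H_v)` and `⊕_w 𝕂(H_w)`. -/
def graphCorr {V W : Type u} (HV : V → Type u) (HW : W → Type u)
    [∀ v, NormedAddCommGroup (HV v)] [∀ v, InnerProductSpace ℂ (HV v)]
    [∀ v, CompleteSpace (HV v)]
    [∀ w, NormedAddCommGroup (HW w)] [∀ w, InnerProductSpace ℂ (HW w)]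
    [∀ w, CompleteSpace (HW w)] (C : Matrix V W Cardinal.{u}) :
    Correspondence.{u} (compactSum HV) (compactSum HW) :=
  sumCorr (A := fun v => compactAlgebra (HV v)) (B := fun w => compactAlgebra (HW w))
    (Edge.src (C := C)) Edge.tgt fun e => stdBimodule (HV e.src) (HW e.tgt)

/-- The product of matrices with cardinal entries, `(C D)_{uw} = ∑_v C_{uv} D_{vw}`. -/
def cardMul {U V W : Type u} (C : Matrix U V Cardinal.{u}) (D : Matrix V W Cardinal.{u}) :
    Matrix U W Cardinal.{u} :=
  Matrix.of fun i k => Cardinal.sum fun j => C i j * D j k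

end CStarCorr

end

noncomputable section

namespace CStarCorr

open scoped ENNReal Topology InnerProductSpace TensorProduct
open Filter

/-! A correspondence over these algebras is determined by the dimensions of a matrix of Hilbert
spaces. Fix a unit vector in each Hilbert space. The rank-one projections `p_v` and `q_w` onto these
vectors are minimal: `p_v A p_v = ℂ p_v`. Different ones are inequivalent: `p_v A p_{v'} = 0`.
Together they generate the algebra as a closed ideal (`MinProjections`). Hence the inner product of
`X` restricted to the corner `p_v X q_w` takes values in `ℂ q_w`, so the corner is a Hilbert space,
and the entry of the matrix at `(v, w)` has to be its dimension.

Choosing an orthonormal basis in every corner gives a frame (`IsFrame`): a family indexed by the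
edges of a graph, with `p_{s e} b_e = b_e`, `⟨b_e, b_e⟩ = q_{r e}`, orthogonality, and `A b_e B`
total in `X`. Frames always exist (`exists_isFrame`) because the corners generate `X`. The relations
determine every `⟨b_e, a b_{e'}⟩`, so correspondences with frames over the same graph are isomorphic
(`IsFrame.isomorphic`). Conversely, the edges from `v` to `w` of any frame form a Hilbert basis of
the corner, so their number is an invariant (`IsFrame.edgeCard_eq`).

The correspondence `X(C)` has a frame indexed by `E_C`, made of elementary tensors of the chosen
unit vectors (`exists_isFrame_graphCorr`). This gives existence and uniqueness in (1), in the form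
of `isomorphic_graphCorr_iff`. For (2), the elementary tensors of frame vectors along composable
pairs of edges are a frame of the interior tensor product (`IsFrame.tensor`), and the number of such
paths is the entry of the matrix product (`edgeCard_paths`). -/

/-- Replaces nested closure arguments: it is applied once for each variable of a product such as `a
· x · g`. -/
theorem map_mem_of_dense_span {E F : Type*} [NormedAddCommGroup E] [NormedSpace ℂ E]
    [NormedAddCommGroup F] [NormedSpace ℂ F] {S : Set E}
    (hS : Dense (Submodule.span ℂ S : Set E)) {N : Submodule ℂ F} (hN : IsClosed (N : Set F))
    (L : E →ₗ[ℂ] F) (hL : Continuous L) (h : ∀ x ∈ S, L x ∈ N) (x : E) : L x ∈ N :=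
  hN.closure_subset (map_mem_closure hL (hS x) fun _ hy =>
    (Submodule.span_le (p := N.comap L)).2 h hy)

/-! ### Hilbert dimension -/

section hilbertBasis

variable {ι ι' : Type u} {E : Type*} [NormedAddCommGroup E] [InnerProductSpace ℂ E]

/-- Each `b' j` is nonzero, hence has a nonzero coefficient against some `b i`, while each `b i`
meets only countably many `b' j`. So `ι'` is a union of countable sets indexed by `ι`, and an
infinite cardinal absorbs the factor `ℵ₀`. -/
theorem HilbertBasis.mk_le_of_infinite [Infinite ι] (b : HilbertBasis ι ℂ E)
    (b' : HilbertBasis ι' ℂ E) : Cardinal.mk ι' ≤ Cardinal.mk ι := by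
  have hcover : (⋃ i, {j : ι' | ⟪b i, b' j⟫_ℂ ≠ 0}) = Set.univ := by
    refine Set.eq_univ_of_forall fun j => ?_
    by_contra hj
    have hz : ∀ i, ⟪b i, b' j⟫_ℂ = 0 := by simpa using hj
    have h0 : b' j = 0 := by
      refine (b.hasSum_repr (b' j)).unique ?_
      simpa only [b.repr_apply_apply, hz, zero_smul] using hasSum_zero
    exact b'.orthonormal.ne_zero j h0
  have hcount : ∀ i, ({j : ι' | ⟪b i, b' j⟫_ℂ ≠ 0} : Set ι').Countable := by
    intro i
    -- The Parseval series of `⟪b i, b i⟫` has terms `⟪b i, b' j⟫ * ⟪b' j, b i⟫`, and a summable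
    -- family has countable support.
    refine (b'.summable_inner_mul_inner (b i) (b i)).countable_support.mono fun j hj => ?_
    exact mul_ne_zero hj fun h => hj (inner_eq_zero_symm.1 h)
  calc Cardinal.mk ι' = Cardinal.mk (⋃ i, {j : ι' | ⟪b i, b' j⟫_ℂ ≠ 0}) := by
        rw [hcover, Cardinal.mk_univ]
    _ ≤ Cardinal.sum fun i => Cardinal.mk {j : ι' | ⟪b i, b' j⟫_ℂ ≠ 0} :=
        Cardinal.mk_iUnion_le_sum_mk
    _ ≤ Cardinal.sum fun _ : ι => Cardinal.aleph0 :=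
        Cardinal.sum_le_sum _ _ fun i => (Cardinal.le_aleph0_iff_set_countable).2 (hcount i)
    _ = Cardinal.mk ι := by
        rw [Cardinal.sum_const', Cardinal.mul_aleph0_eq (Cardinal.aleph0_le_mk ι)]

/-- Any two Hilbert bases of a Hilbert space have the same cardinality. -/
theorem HilbertBasis.mk_eq_mk (b : HilbertBasis ι ℂ E) (b' : HilbertBasis ι' ℂ E) :
    Cardinal.mk ι = Cardinal.mk ι' := by
  -- A finite Hilbert basis is an algebraic basis, so the space is finite-dimensional and every
  -- orthonormal family in it is finite.
  have hfin : ∀ {κ κ' : Type u} (_ : HilbertBasis κ ℂ E) (_ : HilbertBasis κ' ℂ E),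
      Finite κ → Finite κ' := by
    intro κ κ' c c' hκ
    have := Fintype.ofFinite κ
    have := c.toOrthonormalBasis.toBasis.finiteDimensional_of_finite
    exact c'.orthonormal.linearIndependent.finite
  rcases finite_or_infinite ι with h | h
  · have h' := hfin b b' h
    have := Fintype.ofFinite ι
    have := Fintype.ofFinite ι'
    exact mk_eq_mk_of_basis' b.toOrthonormalBasis.toBasis b'.toOrthonormalBasis.toBasis
  · have h' : Infinite ι' := by
      by_contra hn
      rw [not_infinite_iff_finite] at hn
      exact not_finite_iff_infinite.2 h (hfin b' b hn)
    exact le_antisymm (HilbertBasis.mk_le_of_infinite b' b) (HilbertBasis.mk_le_of_infinite b b')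

end hilbertBasis

/-! ### Continuity, isomorphisms and approximate units for correspondences -/

namespace Correspondence

variable {A B : Type*} [NonUnitalCStarAlgebra A] [NonUnitalCStarAlgebra B]
  (X Y : Correspondence.{u} A B)

theorem eq_zero_of_inner_self {x : X.carrier} (h : X.pre.inner x x = 0) : x = 0 := by
  rw [← norm_eq_zero, X.norm_eq, h, norm_zero, Real.sqrt_zero]

theorem norm_inner_le (x y : X.carrier) : ‖X.pre.inner x y‖ ≤ ‖x‖ * ‖y‖ := by
  rw [X.norm_eq x, X.norm_eq y]
  exact X.pre.norm_inner_le x y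

theorem norm_lact_le (a : A) (x : X.carrier) : ‖X.pre.lact a x‖ ≤ ‖a‖ * ‖x‖ := by
  rw [X.norm_eq, X.norm_eq]
  exact X.pre.norm_inner_lact_le a x

theorem norm_ract_le (b : B) (x : X.carrier) : ‖X.pre.ract b x‖ ≤ ‖b‖ * ‖x‖ := by
  rw [X.norm_eq, X.norm_eq]
  exact X.pre.norm_inner_ract_le b x

theorem continuous_lact (a : A) : Continuous fun x => X.pre.lact a x :=
  ((X.pre.lact a).mkContinuous ‖a‖ (X.norm_lact_le a)).continuous

theorem continuous_ract (b : B) : Continuous fun x => X.pre.ract b x :=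
  ((X.pre.ract b).mkContinuous ‖b‖ (X.norm_ract_le b)).continuous

theorem continuous_lact_left (x : X.carrier) : Continuous fun a => X.pre.lact a x :=
  ((X.pre.lact.flip x).mkContinuous ‖x‖ fun a => by
    rw [mul_comm]; exact X.norm_lact_le a x).continuous

theorem continuous_ract_left (x : X.carrier) : Continuous fun b => X.pre.ract b x :=
  ((X.pre.ract.flip x).mkContinuous ‖x‖ fun b => by
    rw [mul_comm]; exact X.norm_ract_le b x).continuous

theorem continuous_inner_right (x : X.carrier) : Continuous fun y => X.pre.inner x y :=
  ((X.pre.inner x).mkContinuous ‖x‖ (X.norm_inner_le x)).continuous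

theorem continuous_inner_left (y : X.carrier) : Continuous fun x => X.pre.inner x y := by
  have h : (fun x => X.pre.inner x y) = fun x => star (X.pre.inner y x) :=
    funext fun x => (X.pre.star_inner y x).symm
  rw [h]
  exact (X.continuous_inner_right y).star

theorem inner_lact_right (a : A) (x y : X.carrier) :
    X.pre.inner x (X.pre.lact a y) = X.pre.inner (X.pre.lact (star a) x) y := by
  rw [X.pre.inner_lact, star_star]

theorem ext_inner {x y : X.carrier} (h : ∀ z, X.pre.inner z x = X.pre.inner z y) : x = y := by
  refine sub_eq_zero.1 (X.eq_zero_of_inner_self ?_)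
  rw [map_sub, h, sub_self]

/-- The two actions of a correspondence commute. -/
theorem lact_ract (a : A) (b : B) (x : X.carrier) :
    X.pre.lact a (X.pre.ract b x) = X.pre.ract b (X.pre.lact a x) :=
  -- Not an axiom of the structure: an adjointable operator is automatically `B`-linear, as testing
  -- against an arbitrary `z` shows.
  X.ext_inner fun z => by
    rw [X.inner_lact_right, X.pre.inner_ract, X.pre.inner_ract, X.inner_lact_right]

variable {X Y}

/-- Preserving inner products forces injectivity, so the map is bijective and its inverse inherits
the compatibilities. -/
theorem Isomorphic.symm (h : X.Isomorphic Y) : Y.Isomorphic X := by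
  obtain ⟨τ, hs, hi, hl, hr⟩ := h
  have hinj : Function.Injective τ := by
    rw [injective_iff_map_eq_zero]
    intro x hx
    refine X.eq_zero_of_inner_self ?_
    rw [← hi, hx, map_zero]
  let e := LinearEquiv.ofBijective τ ⟨hinj, hs⟩
  have he : ∀ y, τ (e.symm y) = y := e.apply_symm_apply
  refine ⟨e.symm.toLinearMap, e.symm.surjective, fun x y => ?_, fun a x => ?_, fun b x => ?_⟩
  · rw [← hi]
    exact congrArg₂ (fun u v => Y.pre.inner u v) (he x) (he y)
  · refine hinj ?_
    rw [hl]
    exact (he _).trans (congrArg _ (he x).symm)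
  · refine hinj ?_
    rw [hr]
    exact (he _).trans (congrArg _ (he x).symm)

/-- Two correspondences are isomorphic if they are spanned by families of vectors with the same
inner products `⟨xᵢ, xⱼ⟩` and the same matrix coefficients `⟨xᵢ, a xⱼ⟩`. -/
theorem isomorphic_of_family {J : Type*} (x : J → X.carrier) (y : J → Y.carrier)
    (hx : Dense (Submodule.span ℂ (Set.range x) : Set X.carrier))
    (hy : Dense (Submodule.span ℂ (Set.range y) : Set Y.carrier))
    (hinner : ∀ i j, X.pre.inner (x i) (x j) = Y.pre.inner (y i) (y j))
    (hlact : ∀ a i j, X.pre.inner (x i) (X.pre.lact a (x j)) =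
      Y.pre.inner (y i) (Y.pre.lact a (y j))) : X.Isomorphic Y := by
  let f := Finsupp.linearCombination ℂ x
  let g := Finsupp.linearCombination ℂ y
  have hf : DenseRange f := by
    change Dense _
    rwa [← LinearMap.coe_range, Finsupp.range_linearCombination]
  have hg : DenseRange g := by
    change Dense _
    rwa [← LinearMap.coe_range, Finsupp.range_linearCombination]
  have hfg : ∀ c d, X.pre.inner (f c) (f d) = Y.pre.inner (g c) (g d) := by
    intro c d
    simp only [f, g, Finsupp.linearCombination_apply, Finsupp.sum, map_sum, LinearMap.sum_apply,
      map_smulₛₗ, LinearMap.smul_apply, hinner]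
  have hfga : ∀ a c d, X.pre.inner (f c) (X.pre.lact a (f d)) =
      Y.pre.inner (g c) (Y.pre.lact a (g d)) := by
    intro a c d
    simp only [f, g, Finsupp.linearCombination_apply, Finsupp.sum, map_sum, LinearMap.sum_apply,
      map_smulₛₗ, LinearMap.smul_apply, hlact]
  -- Equal inner products make `f c ↦ g c` well defined and isometric, although `f` and `g` need not
  -- be injective; density of both ranges extends it to a unitary.
  let τ := (LinearEquiv.refl ℂ (J →₀ ℂ)).extendOfIsometry f g hf hg fun c => by
    rw [X.norm_eq, Y.norm_eq, hfg]
    rfl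
  have hτ : ∀ c, τ (f c) = g c := fun c => LinearEquiv.extendOfIsometry_eq _ _ _ _ _ _ _
  have hτi : ∀ ξ η, Y.pre.inner (τ ξ) (τ η) = X.pre.inner ξ η := by
    intro ξ η
    refine hf.induction_on (p := fun ξ => Y.pre.inner (τ ξ) (τ η) = X.pre.inner ξ η) ξ
      (isClosed_eq ((Y.continuous_inner_left _).comp τ.continuous)
        (X.continuous_inner_left _)) fun c => ?_
    refine hf.induction_on (p := fun η => Y.pre.inner (τ (f c)) (τ η) = X.pre.inner (f c) η) η
      (isClosed_eq ((Y.continuous_inner_right _).comp τ.continuous)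
        (X.continuous_inner_right _)) fun d => ?_
    rw [hτ, hτ, hfg]
  refine ⟨τ.toLinearEquiv.toLinearMap, τ.surjective, hτi, fun a ξ => ?_, fun b ξ => ?_⟩
  · change τ (X.pre.lact a ξ) = Y.pre.lact a (τ ξ)
    refine hf.induction_on (p := fun ξ => τ (X.pre.lact a ξ) = Y.pre.lact a (τ ξ)) ξ
      (isClosed_eq (τ.continuous.comp (X.continuous_lact a))
        ((Y.continuous_lact a).comp τ.continuous)) fun d => Y.ext_inner fun z => ?_
    -- Testing against the dense vectors `g c = τ (f c)` turns the intertwining relation into the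
    -- equality of matrix coefficients `hfga`.
    refine hg.induction_on (p := fun z => Y.pre.inner z (τ (X.pre.lact a (f d))) =
      Y.pre.inner z (Y.pre.lact a (τ (f d)))) z
      (isClosed_eq (Y.continuous_inner_left _) (Y.continuous_inner_left _)) fun c => ?_
    rw [← hτ c, hτi, hτ, hτ, hfga]
  · change τ (X.pre.ract b ξ) = Y.pre.ract b (τ ξ)
    -- The right action needs no hypothesis on the families: preservation of inner products and
    -- surjectivity of `τ` already give `B`-linearity.
    refine Y.ext_inner fun z => ?_
    obtain ⟨z, rfl⟩ := τ.surjective z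
    rw [Y.pre.inner_ract, hτi, hτi, X.pre.inner_ract]

/-- Every vector of a Hilbert `B`-module is a limit of vectors `x · b`. -/
theorem mem_of_ract_mem (N : Set X.carrier) (hN : IsClosed N) (x : X.carrier)
    (h : ∀ b, X.pre.ract b x ∈ N) : x ∈ N := by
  let _ := CStarAlgebra.spectralOrder B
  have _ := CStarAlgebra.spectralOrderedRing B
  have hu := CStarAlgebra.increasingApproximateUnit B
  have _ := hu.neBot
  set t := X.pre.inner x x with ht
  -- An approximate unit of `B` is one for the module: `‖x b - x‖² = ‖b⋆ (t b - t) - (t b - t)‖ ≤ 2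
  -- ‖t b - t‖` once `‖b‖ ≤ 1`.
  have hlim : Tendsto (fun b => X.pre.ract b x) (CStarAlgebra.approximateUnit B) (𝓝 x) := by
    have h1 : ∀ b, ‖X.pre.ract b x - x‖ = √‖star b * (t * b - t) - (t * b - t)‖ := by
      intro b
      rw [X.norm_eq]
      congr 2
      simp only [map_sub, LinearMap.sub_apply, X.pre.inner_ract, X.pre.inner_ract_left, ← ht,
        mul_sub, mul_assoc]
      abel
    rw [tendsto_iff_norm_sub_tendsto_zero]
    have h2 : Tendsto (fun b => ‖t * b - t‖) (CStarAlgebra.approximateUnit B) (𝓝 0) :=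
      tendsto_iff_norm_sub_tendsto_zero.1 (hu.tendsto_mul_left t)
    have h3 : Tendsto (fun b => √(2 * ‖t * b - t‖)) (CStarAlgebra.approximateUnit B) (𝓝 0) := by
      simpa using (h2.const_mul 2).sqrt
    refine squeeze_zero' (Eventually.of_forall fun _ => norm_nonneg _) ?_ h3
    filter_upwards [hu.eventually_norm] with b hb
    rw [h1]
    refine Real.sqrt_le_sqrt ((norm_sub_le _ _).trans ?_)
    have h4 := norm_mul_le (star b) (t * b - t)
    rw [norm_star] at h4
    nlinarith [norm_nonneg (t * b - t)]
  exact hN.mem_of_tendsto hlim (Eventually.of_forall h)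

end Correspondence

/-! ### Minimal projections -/

/-- A family of pairwise inequivalent minimal projections of a C⋆-algebra that generates it as a
closed ideal; `state v` is the pure state of `proj v`. -/
structure MinProjections (V A : Type*) [NonUnitalCStarAlgebra A] where
  proj : V → A
  state : V → A →ₗ[ℂ] ℂ
  star_proj : ∀ v, star (proj v) = proj v
  norm_proj : ∀ v, ‖proj v‖ = 1
  proj_mul_self : ∀ v, proj v * proj v = proj v
  proj_mul_mul : ∀ v a, proj v * a * proj v = state v a • proj v
  proj_mul_mul_of_ne : ∀ v v', v ≠ v' → ∀ a, proj v * a * proj v' = 0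
  state_star_mul_self : ∀ v a, ∃ t : ℝ, 0 ≤ t ∧ state v (star a * a) = t
  dense_span : Dense (Submodule.span ℂ
    (Set.range fun p : V × A × A => p.2.1 * proj p.1 * p.2.2) : Set A)

namespace MinProjections

variable {V A : Type*} [NonUnitalCStarAlgebra A] (π : MinProjections V A)

theorem proj_ne_zero (v : V) : π.proj v ≠ 0 := by
  rw [← norm_ne_zero_iff, π.norm_proj]; exact one_ne_zero

/-- Beyond linearity and positivity, properties of `state` are not postulated: they are read off
from `proj_mul_mul` by cancelling the nonzero projection. -/
theorem smul_proj_injective (v : V) {c d : ℂ} (h : c • π.proj v = d • π.proj v) : c = d :=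
  smul_left_injective ℂ (π.proj_ne_zero v) h

theorem state_star (v : V) (a : A) : π.state v (star a) = starRingEnd ℂ (π.state v a) := by
  refine π.smul_proj_injective v ?_
  rw [← π.proj_mul_mul]
  have := congrArg star (π.proj_mul_mul v a)
  simpa only [star_mul, star_smul, π.star_proj, mul_assoc, starRingEnd_apply] using this

theorem state_proj (v : V) : π.state v (π.proj v) = 1 := by
  refine π.smul_proj_injective v ?_
  rw [← π.proj_mul_mul, π.proj_mul_self, π.proj_mul_self, one_smul]

end MinProjections

/-! ### Frames of a correspondence -/

/-- A family of vectors of a correspondence, indexed by the edges `e : s e → r e` of a graph, that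
satisfies the relations of the elementary tensors of unit vectors in the correspondence of that
graph, and generates the correspondence. -/
structure IsFrame {V W A B : Type*} [NonUnitalCStarAlgebra A] [NonUnitalCStarAlgebra B]
    (π : MinProjections V A) (ρ : MinProjections W B) (X : Correspondence.{u} A B)
    {I : Type*} (s : I → V) (r : I → W) (b : I → X.carrier) : Prop where
  lact_proj : ∀ e, X.pre.lact (π.proj (s e)) (b e) = b e
  inner_self : ∀ e, X.pre.inner (b e) (b e) = ρ.proj (r e)
  inner_of_ne : ∀ e e', e ≠ e' → X.pre.inner (b e) (b e') = 0
  dense_span : Dense (Submodule.span ℂ (Set.range fun p : I × A × B =>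
    X.pre.ract p.2.2 (X.pre.lact p.2.1 (b p.1))) : Set X.carrier)

/-- The number of edges from `v` to `w`. -/
def edgeCard {V W : Type*} {I : Type u} (s : I → V) (r : I → W) (v : V) (w : W) : Cardinal.{u} :=
  Cardinal.mk {e : I // s e = v ∧ r e = w}

namespace IsFrame

variable {V W A B : Type*} [NonUnitalCStarAlgebra A] [NonUnitalCStarAlgebra B]
  {π : MinProjections V A} {ρ : MinProjections W B} {X Y : Correspondence.{u} A B}
  {I J : Type u} {s : I → V} {r : I → W} {b : I → X.carrier}

/-- As `b e` is fixed by the minimal projection `p`, the element `p a` may be replaced by `p a p`, a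
scalar multiple of `p`. -/
theorem proj_lact (hb : IsFrame π ρ X s r b) (a : A) (e : I) :
    X.pre.lact (π.proj (s e)) (X.pre.lact a (b e)) = π.state (s e) a • b e := by
  conv_lhs => rw [← hb.lact_proj e]
  rw [← X.pre.lact_mul, ← X.pre.lact_mul, π.proj_mul_mul, map_smul,
    LinearMap.smul_apply, hb.lact_proj]

theorem proj_lact_of_ne (hb : IsFrame π ρ X s r b) (a : A) {v : V} {e : I}
    (he : s e ≠ v) : X.pre.lact (π.proj v) (X.pre.lact a (b e)) = 0 := by
  rw [← hb.lact_proj e, ← X.pre.lact_mul, ← X.pre.lact_mul,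
    π.proj_mul_mul_of_ne _ _ he.symm, map_zero, LinearMap.zero_apply]

/-- Invariance on the right is forced by `inner_self`: with `q = ⟨b e, b e⟩` a projection, the inner
square of `b e · q - b e` is `q - q - q + q`. -/
theorem ract_proj (hb : IsFrame π ρ X s r b) (e : I) :
    X.pre.ract (ρ.proj (r e)) (b e) = b e := by
  refine sub_eq_zero.1 (X.eq_zero_of_inner_self ?_)
  simp only [map_sub, LinearMap.sub_apply, X.pre.inner_ract, X.pre.inner_ract_left, hb.inner_self,
    ρ.star_proj, ρ.proj_mul_self, sub_self]

theorem ract_ract (hb : IsFrame π ρ X s r b) (g : B) (e : I) :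
    X.pre.ract (ρ.proj (r e)) (X.pre.ract g (b e)) = ρ.state (r e) g • b e := by
  conv_lhs => rw [← hb.ract_proj e]
  rw [← X.pre.ract_mul, ← X.pre.ract_mul, ← mul_assoc, ρ.proj_mul_mul, map_smul,
    LinearMap.smul_apply, hb.ract_proj]

theorem ract_ract_of_ne (hb : IsFrame π ρ X s r b) (g : B) {w : W} {e : I}
    (he : r e ≠ w) : X.pre.ract (ρ.proj w) (X.pre.ract g (b e)) = 0 := by
  rw [← hb.ract_proj e, ← X.pre.ract_mul, ← X.pre.ract_mul, ← mul_assoc,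
    ρ.proj_mul_mul_of_ne _ _ he, map_zero, LinearMap.zero_apply]

/-- Together with `inner_lact_of_ne`, this expresses every matrix coefficient `⟨b e, a b e'⟩`
through the graph, the states and the projections alone, with no reference to `X`. -/
theorem inner_lact_self (hb : IsFrame π ρ X s r b) (a : A) (e : I) :
    X.pre.inner (b e) (X.pre.lact a (b e)) = π.state (s e) a • ρ.proj (r e) := by
  rw [← hb.inner_self, ← map_smul, ← hb.proj_lact a, X.inner_lact_right (π.proj (s e)),
    π.star_proj, hb.lact_proj]

/-- Moving the projection `p` of `b e` to the other side leaves `p a b e'`, which is a multiple of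
`b e'` if the sources agree and zero otherwise. -/
theorem inner_lact_of_ne (hb : IsFrame π ρ X s r b) (a : A) {e e' : I}
    (he : e ≠ e') : X.pre.inner (b e) (X.pre.lact a (b e')) = 0 := by
  rw [← hb.lact_proj e, X.pre.inner_lact, π.star_proj]
  by_cases hs : s e' = s e
  · rw [← hs, hb.proj_lact, map_smul, hb.inner_of_ne e e' he, smul_zero]
  · rw [hb.proj_lact_of_ne a hs, map_zero]

/-- Correspondences with frames over the same graph are isomorphic. -/
theorem isomorphic {c : I → Y.carrier} (hb : IsFrame π ρ X s r b) (hc : IsFrame π ρ Y s r c) :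
    X.Isomorphic Y := by
  have hbc : ∀ a e e', X.pre.inner (b e) (X.pre.lact a (b e')) =
      Y.pre.inner (c e) (Y.pre.lact a (c e')) := by
    intro a e e'
    by_cases he : e = e'
    · subst he
      rw [hb.inner_lact_self, hc.inner_lact_self]
    · rw [hb.inner_lact_of_ne a he, hc.inner_lact_of_ne a he]
  -- On the generators `a · b e · g`, the algebra elements can be moved out of or collected inside
  -- the inner product, so only the coefficients in `hbc` remain.
  refine Correspondence.isomorphic_of_family _ _ hb.dense_span hc.dense_span ?_ ?_
  · rintro ⟨e, a, g⟩ ⟨e', a', g'⟩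
    simp only [X.pre.inner_ract, X.pre.inner_ract_left, Y.pre.inner_ract, Y.pre.inner_ract_left,
      X.pre.inner_lact, Y.pre.inner_lact, ← X.pre.lact_mul, ← Y.pre.lact_mul, hbc]
  · rintro f ⟨e, a, g⟩ ⟨e', a', g'⟩
    simp only [X.lact_ract, Y.lact_ract, X.pre.inner_ract, X.pre.inner_ract_left,
      Y.pre.inner_ract, Y.pre.inner_ract_left,
      X.pre.inner_lact, Y.pre.inner_lact, ← X.pre.lact_mul, ← Y.pre.lact_mul, hbc]

theorem reindex (hb : IsFrame π ρ X s r b) (σ : J ≃ I) :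
    IsFrame π ρ X (fun j => s (σ j)) (fun j => r (σ j)) (fun j => b (σ j)) where
  lact_proj e := hb.lact_proj _
  inner_self e := hb.inner_self _
  inner_of_ne e e' he := hb.inner_of_ne _ _ (σ.injective.ne he)
  dense_span := by
    refine hb.dense_span.mono (Submodule.span_mono ?_)
    rintro _ ⟨⟨e, a, g⟩, rfl⟩
    exact ⟨⟨σ.symm e, a, g⟩, by simp⟩

/-- Correspondences with frames over graphs with the same numbers of edges are isomorphic. -/
theorem isomorphic_of_edgeCard {s' : J → V} {r' : J → W} {c : J → Y.carrier}
    (hb : IsFrame π ρ X s r b) (hc : IsFrame π ρ Y s' r' c)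
    (hcard : ∀ v w, edgeCard s r v w = edgeCard s' r' v w) : X.Isomorphic Y := by
  let f : I → V × W := fun e => (s e, r e)
  let f' : J → V × W := fun e => (s' e, r' e)
  have hf : ∀ p : V × W, Nonempty ({e // f e = p} ≃ {e // f' e = p}) := by
    rintro ⟨v, w⟩
    rw [← Cardinal.eq]
    simpa only [f, f', Prod.mk.injEq, edgeCard] using hcard v w
  -- Bijections between the fibres over each pair of vertices glue to a bijection of the edge sets
  -- that preserves endpoints.
  let σ : I ≃ J := (Equiv.sigmaFiberEquiv f).symm.trans
    ((Equiv.sigmaCongrRight fun p => (hf p).some).trans (Equiv.sigmaFiberEquiv f'))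
  have hσ : ∀ e, f' (σ e) = f e := fun e => ((hf (f e)).some ⟨e, rfl⟩).2
  have h1 : (fun e => s' (σ e)) = s := funext fun e => congrArg Prod.fst (hσ e)
  have h2 : (fun e => r' (σ e)) = r := funext fun e => congrArg Prod.snd (hσ e)
  have h3 := hc.reindex σ
  rw [h1, h2] at h3
  exact hb.isomorphic h3

/-- Frames are carried along isomorphisms. -/
theorem of_isomorphic (hb : IsFrame π ρ X s r b) (hXY : X.Isomorphic Y) :
    ∃ c, IsFrame π ρ Y s r c := by
  obtain ⟨τ, hs, hi, hl, hr⟩ := hXY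
  refine ⟨fun e => τ (b e), fun e => ?_, fun e => ?_, fun e e' he => ?_, ?_⟩
  · rw [← hl, hb.lact_proj]
  · rw [hi, hb.inner_self]
  · rw [hi, hb.inner_of_ne e e' he]
  · have hτ : Continuous τ := (τ.mkContinuous 1 fun x => by
      rw [Y.norm_eq, hi, ← X.norm_eq, one_mul]).continuous
    have := hs.denseRange.dense_image hτ hb.dense_span
    rw [← Submodule.map_coe, Submodule.map_span, ← Set.range_comp] at this
    convert this using 5 with p
    simp only [Function.comp_apply, hl, hr]

end IsFrame

/-! ### Multiplicity spaces -/

section corner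

variable {V W A B : Type*} [NonUnitalCStarAlgebra A] [NonUnitalCStarAlgebra B]

/-- The multiplicity space `p_v X q_w` of a correspondence `X`. -/
def corner (π : MinProjections V A) (ρ : MinProjections W B) (X : Correspondence.{u} A B)
    (v : V) (w : W) : Submodule ℂ X.carrier where
  carrier := {x | X.pre.lact (π.proj v) x = x ∧ X.pre.ract (ρ.proj w) x = x}
  add_mem' := by
    rintro x y ⟨hx, hx'⟩ ⟨hy, hy'⟩
    exact ⟨by rw [map_add, hx, hy], by rw [map_add, hx', hy']⟩
  zero_mem' := ⟨map_zero _, map_zero _⟩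
  smul_mem' := by
    rintro c x ⟨hx, hx'⟩
    exact ⟨by rw [map_smul, hx], by rw [map_smul, hx']⟩

variable {π : MinProjections V A} {ρ : MinProjections W B} {X : Correspondence.{u} A B}
  {v : V} {w : W}

theorem isClosed_corner : IsClosed (corner π ρ X v w : Set X.carrier) :=
  (isClosed_eq (X.continuous_lact _) continuous_id).inter
    (isClosed_eq (X.continuous_ract _) continuous_id)

theorem corner_proj_mem (x : X.carrier) :
    X.pre.ract (ρ.proj w) (X.pre.lact (π.proj v) x) ∈ corner π ρ X v w :=
  ⟨by rw [X.lact_ract, ← X.pre.lact_mul, π.proj_mul_self],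
    by rw [← X.pre.ract_mul, ρ.proj_mul_self]⟩

/-- The value lies in `q B q = ℂ q`; this is what makes the corner a Hilbert space. -/
theorem corner_inner_eq {x y : X.carrier} (hx : x ∈ corner π ρ X v w)
    (hy : y ∈ corner π ρ X v w) :
    X.pre.inner x y = ρ.state w (X.pre.inner x y) • ρ.proj w := by
  rw [← ρ.proj_mul_mul]
  conv_lhs => rw [← hx.2, ← hy.2, X.pre.inner_ract_left, X.pre.inner_ract, ρ.star_proj,
    ← mul_assoc]

theorem corner_inner_eq_zero {v' : V} {w' : W} {x y : X.carrier} (hx : x ∈ corner π ρ X v w)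
    (hy : y ∈ corner π ρ X v' w') (h : v ≠ v' ∨ w ≠ w') : X.pre.inner x y = 0 := by
  rcases h with h | h
  · rw [← hx.1, ← hy.1, X.pre.inner_lact, π.star_proj, ← X.pre.lact_mul]
    have : π.proj v * π.proj v' = 0 := by
      rw [← π.proj_mul_self v, π.proj_mul_mul_of_ne v v' h]
    rw [this, map_zero, LinearMap.zero_apply, map_zero]
  · rw [← hx.2, ← hy.2, X.pre.inner_ract_left, X.pre.inner_ract, ρ.star_proj, ← mul_assoc,
      ρ.proj_mul_mul_of_ne w w' h]

/-- The scalar inner product induces the norm that the corner already has as a subspace: `⟨x, x⟩ = t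
q` with `t ≥ 0` and `‖q‖ = 1`, so `‖x‖² = t`. Completeness then follows from closedness in `X`. -/
instance : InnerProductSpace ℂ (corner π ρ X v w) where
  inner x y := ρ.state w (X.pre.inner x.1 y.1)
  norm_sq_eq_re_inner x := by
    obtain ⟨c, hc⟩ := X.pre.inner_self_pos x.1
    obtain ⟨t, ht, hct⟩ := ρ.state_star_mul_self w c
    have h1 : ‖X.pre.inner x.1 x.1‖ = t := by
      rw [corner_inner_eq x.2 x.2, hc, hct, norm_smul, ρ.norm_proj, mul_one, Complex.norm_real,
        Real.norm_of_nonneg ht]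
    have h2 : ‖x‖ ^ 2 = t := by
      rw [← h1]
      change ‖x.1‖ ^ 2 = _
      rw [X.norm_eq, Real.sq_sqrt (norm_nonneg _)]
    rw [h2, hc, hct]
    rfl
  conj_inner_symm x y := by
    rw [← ρ.state_star, X.pre.star_inner]
  add_left x y z := by
    rw [← map_add]
    exact congrArg _ (by simp)
  smul_left x y c := by
    rw [← smul_eq_mul, ← map_smul]
    exact congrArg _ (by simp)

instance : CompleteSpace (corner π ρ X v w) := isClosed_corner.completeSpace_coe

theorem corner_inner_def (x y : corner π ρ X v w) :
    ⟪x, y⟫_ℂ = ρ.state w (X.pre.inner x.1 y.1) := rfl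

end corner

namespace IsFrame

variable {V W A B : Type*} [NonUnitalCStarAlgebra A] [NonUnitalCStarAlgebra B]
  {π : MinProjections V A} {ρ : MinProjections W B} {X : Correspondence.{u} A B}
  {I J : Type u} {s : I → V} {r : I → W} {b : I → X.carrier}

theorem mem_corner (hb : IsFrame π ρ X s r b) (e : I) : b e ∈ corner π ρ X (s e) (r e) :=
  ⟨hb.lact_proj e, hb.ract_proj e⟩

/-- The frame vectors of the edges from `v` to `w`, as vectors of the multiplicity space. -/
def cornerVec (hb : IsFrame π ρ X s r b) (v : V) (w : W) (e : {e : I // s e = v ∧ r e = w}) :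
    corner π ρ X v w :=
  ⟨b e, by obtain ⟨e, rfl, rfl⟩ := e; exact hb.mem_corner e⟩

theorem orthonormal_cornerVec (hb : IsFrame π ρ X s r b) (v : V) (w : W) :
    Orthonormal ℂ (hb.cornerVec v w) := by
  classical
  rw [orthonormal_iff_ite]
  rintro ⟨e, he⟩ ⟨e', he'⟩
  rw [corner_inner_def]
  change ρ.state w (X.pre.inner (b e) (b e')) = _
  split_ifs with hee
  · obtain rfl : e = e' := congrArg Subtype.val hee
    rw [hb.inner_self, he.2, ρ.state_proj]
  · rw [hb.inner_of_ne e e' (fun h => hee (Subtype.ext h)), map_zero]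

/-- The compression `x ↦ p x q` is the identity on the corner. It sends a generator `a · b e · g` to
a multiple of `b e` if `e` runs from `v` to `w`, and to zero otherwise, so totality passes from `X`
to the corner. -/
theorem dense_span_cornerVec (hb : IsFrame π ρ X s r b) (v : V) (w : W) :
    ⊤ ≤ (Submodule.span ℂ (Set.range (hb.cornerVec v w))).topologicalClosure := by
  let P : X.carrier →ₗ[ℂ] corner π ρ X v w :=
    LinearMap.codRestrict _ ((X.pre.ract (ρ.proj w)).comp (X.pre.lact (π.proj v))) corner_proj_mem
  have hP : Continuous P :=
    ((X.continuous_ract _).comp (X.continuous_lact _)).subtype_mk _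
  rintro x -
  have hx : P x.1 = x := Subtype.ext (by
    change X.pre.ract _ (X.pre.lact _ x.1) = x.1
    rw [x.2.1, x.2.2])
  rw [← hx]
  refine map_mem_of_dense_span hb.dense_span (Submodule.isClosed_topologicalClosure _) P hP ?_ x.1
  rintro _ ⟨⟨e, a, g⟩, rfl⟩
  refine Submodule.le_topologicalClosure _ ?_
  have hPe : (P (X.pre.ract g (X.pre.lact a (b e)))).1 =
      X.pre.lact (π.proj v) (X.pre.lact a (X.pre.ract (ρ.proj w) (X.pre.ract g (b e)))) := by
    change X.pre.ract _ (X.pre.lact _ _) = _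
    simp only [X.lact_ract]
  by_cases he : s e = v ∧ r e = w
  · have : P (X.pre.ract g (X.pre.lact a (b e))) =
        (ρ.state w g * π.state v a) • hb.cornerVec v w ⟨e, he⟩ := by
      refine Subtype.ext (hPe.trans ?_)
      change _ = (ρ.state w g * π.state v a) • b e
      obtain ⟨rfl, rfl⟩ := he
      rw [hb.ract_ract, map_smul, map_smul, hb.proj_lact, smul_smul]
    rw [this]
    exact Submodule.smul_mem _ _ (Submodule.subset_span ⟨_, rfl⟩)
  · have : P (X.pre.ract g (X.pre.lact a (b e))) = 0 := by
      refine Subtype.ext (hPe.trans ?_)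
      change _ = (0 : X.carrier)
      by_cases hr : r e = w
      · have hs : s e ≠ v := fun hs => he ⟨hs, hr⟩
        simp only [X.lact_ract]
        rw [hb.proj_lact_of_ne a hs, map_zero, map_zero]
      · rw [hb.ract_ract_of_ne g hr, map_zero, map_zero]
    rw [this]
    exact Submodule.zero_mem _

/-- The numbers of edges of a frame are determined by the correspondence. -/
theorem edgeCard_eq {s' : J → V} {r' : J → W} {c : J → X.carrier}
    (hb : IsFrame π ρ X s r b) (hc : IsFrame π ρ X s' r' c) (v : V) (w : W) :
    edgeCard s r v w = edgeCard s' r' v w :=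
  HilbertBasis.mk_eq_mk
    (HilbertBasis.mk (hb.orthonormal_cornerVec v w) (hb.dense_span_cornerVec v w))
    (HilbertBasis.mk (hc.orthonormal_cornerVec v w) (hc.dense_span_cornerVec v w))

end IsFrame

/-! ### Existence of frames -/

/-- Every correspondence has a frame. -/
theorem exists_isFrame {V W : Type u} {A B : Type*} [NonUnitalCStarAlgebra A]
    [NonUnitalCStarAlgebra B] (π : MinProjections V A) (ρ : MinProjections W B)
    (X : Correspondence.{u} A B) :
    ∃ (I : Type u) (s : I → V) (r : I → W) (b : I → X.carrier), IsFrame π ρ X s r b := by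
  -- The frame is the disjoint union of orthonormal bases of all the corners.
  have hex : ∀ v w, ∃ (S : Set (corner π ρ X v w)) (c : HilbertBasis S ℂ (corner π ρ X v w)),
      ⇑c = ((↑) : S → corner π ρ X v w) := fun v w => exists_hilbertBasis ℂ _
  choose S c hc using hex
  let I := Σ p : V × W, S p.1 p.2
  let b : I → X.carrier := fun e => (e.2.1 : corner π ρ X e.1.1 e.1.2).1
  have hmem : ∀ e : I, b e ∈ corner π ρ X e.1.1 e.1.2 := fun e => e.2.1.2
  refine ⟨I, fun e => e.1.1, fun e => e.1.2, b, fun e => (hmem e).1, fun e => ?_,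
    fun e e' he => ?_, ?_⟩
  · rw [corner_inner_eq (hmem e) (hmem e)]
    have h1 := (c e.1.1 e.1.2).orthonormal.1 e.2
    rw [hc] at h1
    have h2 := inner_self_eq_norm_sq_to_K (𝕜 := ℂ) e.2.1
    rw [h1, corner_inner_def] at h2
    change ρ.state e.1.2 (X.pre.inner (b e) (b e)) = _ at h2
    rw [h2]
    simp
  · obtain ⟨⟨v, w⟩, x⟩ := e
    obtain ⟨⟨v', w'⟩, x'⟩ := e'
    by_cases hv : v = v'
    · by_cases hw : w = w'
      · subst hv hw
        have hne : x ≠ x' := fun h => he (by rw [h])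
        have h1 := (c v w).orthonormal.2 hne
        rw [hc, corner_inner_def] at h1
        rw [corner_inner_eq (hmem ⟨(v, w), x⟩) (hmem ⟨(v, w), x'⟩)]
        change ρ.state w (X.pre.inner x.1.1 x'.1.1) • ρ.proj w = 0
        rw [h1, zero_smul]
      · exact corner_inner_eq_zero (hmem _) (hmem _) (Or.inr hw)
    · exact corner_inner_eq_zero (hmem _) (hmem _) (Or.inl hv)
  · set N := (Submodule.span ℂ (Set.range fun p : I × A × B =>
      X.pre.ract p.2.2 (X.pre.lact p.2.1 (b p.1)))).topologicalClosure with hN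
    have hNc : IsClosed (N : Set X.carrier) := Submodule.isClosed_topologicalClosure _
    have h1 : ∀ v w (m : corner π ρ X v w) a g, X.pre.ract g (X.pre.lact a m.1) ∈ N := by
      intro v w m a g
      refine map_mem_of_dense_span (S := Set.range (c v w))
        (Submodule.dense_iff_topologicalClosure_eq_top.2 (c v w).dense_span) hNc
        ((X.pre.ract g).comp ((X.pre.lact a).comp (corner π ρ X v w).subtype))
        ((X.continuous_ract g).comp ((X.continuous_lact a).comp continuous_subtype_val)) ?_ m
      rintro _ ⟨x, rfl⟩
      rw [hc]
      exact Submodule.le_topologicalClosure _ (Submodule.subset_span ⟨(⟨(v, w), x⟩, a, g), rfl⟩)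
    -- By density the algebra elements may be taken of the form `a p a'` and `g q g'`; regrouping as
    -- `a · (p a' x g q) · g'` exhibits a corner vector in the middle.
    have h2 : ∀ a x g, X.pre.ract g (X.pre.lact a x) ∈ N := by
      intro a x g
      refine map_mem_of_dense_span π.dense_span hNc ((X.pre.ract g).comp (X.pre.lact.flip x))
        ((X.continuous_ract g).comp (X.continuous_lact_left x)) ?_ a
      rintro _ ⟨⟨v, a, a'⟩, rfl⟩
      refine map_mem_of_dense_span ρ.dense_span hNc
        (X.pre.ract.flip (X.pre.lact (a * π.proj v * a') x)) (X.continuous_ract_left _) ?_ g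
      rintro _ ⟨⟨w, g, g'⟩, rfl⟩
      change X.pre.ract (g * ρ.proj w * g') (X.pre.lact (a * π.proj v * a') x) ∈ N
      have := h1 v w ⟨_, corner_proj_mem (X.pre.lact a' (X.pre.ract g x))⟩ a g'
      convert this using 1
      simp only [X.lact_ract, X.pre.lact_mul, X.pre.ract_mul]
    -- The right factor is removed by an approximate unit of `B`, the left one afterwards by
    -- nondegeneracy of the left action.
    have h3 : ∀ a x, X.pre.lact a x ∈ N := fun a x =>
      Correspondence.mem_of_ract_mem (N : Set X.carrier) hNc _ fun g => h2 a x g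
    intro x
    change x ∈ N
    refine map_mem_of_dense_span X.nondegenerate hNc LinearMap.id continuous_id ?_ x
    rintro _ ⟨a, x, rfl⟩
    exact h3 a x

/-! ### Rank-one operators and compact operators -/

section compact

variable {H : Type*} [NormedAddCommGroup H] [InnerProductSpace ℂ H] [CompleteSpace H]

theorem star_theta (x y : H) : star (theta H x y) = theta H y x :=
  Subtype.ext (InnerProductSpace.adjoint_rankOne x y)

/-- With all four vectors equal to a unit vector `h`, this is minimality of the rank-one projection:
`p T p = ⟨h, T h⟩ p`. -/
theorem theta_mul_mul (x y x' y' : H) (T : compactAlgebra H) :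
    theta H x y * T * theta H x' y' = ⟪y, T.1 x'⟫_ℂ • theta H x y' := by
  refine Subtype.ext (ContinuousLinearMap.ext fun z => ?_)
  change InnerProductSpace.rankOne ℂ x y (T.1 (InnerProductSpace.rankOne ℂ x' y' z)) =
    ⟪y, T.1 x'⟫_ℂ • InnerProductSpace.rankOne ℂ x y' z
  simp only [InnerProductSpace.rankOne_apply, map_smul, smul_smul, mul_comm]

theorem theta_mul (x y x' y' : H) :
    theta H x y * theta H x' y' = ⟪y, x'⟫_ℂ • theta H x y' := by
  refine Subtype.ext (ContinuousLinearMap.ext fun z => ?_)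
  change InnerProductSpace.rankOne ℂ x y (InnerProductSpace.rankOne ℂ x' y' z) =
    ⟪y, x'⟫_ℂ • InnerProductSpace.rankOne ℂ x y' z
  simp only [InnerProductSpace.rankOne_apply, inner_smul_right, smul_smul, mul_comm]

theorem norm_theta (x y : H) : ‖theta H x y‖ = ‖x‖ * ‖y‖ :=
  InnerProductSpace.norm_rankOne (𝕜 := ℂ) x y

/-- The projection of a compact operator to a finite-dimensional subspace has finite rank. -/
theorem starProjection_comp_mem_span (T : compactAlgebra H) (U : Submodule ℂ H)
    [FiniteDimensional ℂ U] :
    ∃ S ∈ Submodule.span ℂ (Set.range fun p : H × H => theta H p.1 p.2),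
      S.1 = U.starProjection ∘L T.1 := by
  let e := stdOrthonormalBasis ℂ U
  -- Expanding `T z` in the orthonormal basis gives `∑ e_i ⟨e_i, T z⟩ = ∑ e_i ⟨T⋆ e_i, z⟩`.
  refine ⟨∑ i, theta H (e i : H) (ContinuousLinearMap.adjoint T.1 (e i : H)),
    Submodule.sum_mem _ fun i _ => Submodule.subset_span ⟨(_, _), rfl⟩, ?_⟩
  refine ContinuousLinearMap.ext fun z => ?_
  rw [AddSubmonoidClass.coe_finsetSum, _root_.sum_apply]
  change ∑ i, InnerProductSpace.rankOne ℂ _ _ z = U.starProjection (T.1 z)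
  rw [Submodule.starProjection_apply, e.orthogonalProjectionOnto_apply_eq_sum, Submodule.coe_sum]
  refine Finset.sum_congr rfl fun i _ => ?_
  rw [InnerProductSpace.rankOne_apply, ContinuousLinearMap.adjoint_inner_left]
  rfl

/-- The finite rank operators are dense in the compact operators. -/
theorem dense_span_theta :
    Dense (Submodule.span ℂ (Set.range fun p : H × H => theta H p.1 p.2) :
      Set (compactAlgebra H)) := by
  intro T
  rw [Metric.mem_closure_iff]
  intro ε hε
  -- The image of the unit ball has a finite `ε / 2`-net. Projecting to the span `U` of the net
  -- moves `T z` no further than its distance to the nearest net point, so compressing `T` to `U`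
  -- costs at most `ε / 2`.
  have hc := ((isCompactOperator_iff_isCompact_closure_image_closedBall
    (T.1 : H →ₗ[ℂ] H) one_pos).1 T.2).totallyBounded.subset subset_closure
  obtain ⟨t, htf, ht⟩ := Metric.totallyBounded_iff.1 hc (ε / 2) (by positivity)
  let U := Submodule.span ℂ t
  have : FiniteDimensional ℂ U := FiniteDimensional.span_of_finite ℂ htf
  obtain ⟨S, hS, hST⟩ := starProjection_comp_mem_span T U
  refine ⟨S, hS, ?_⟩
  rw [dist_eq_norm]
  change ‖T.1 - S.1‖ < ε
  refine lt_of_le_of_lt (b := ε / 2) ?_ (by linarith)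
  refine ContinuousLinearMap.opNorm_le_of_unit_norm (by positivity) fun z hz => ?_
  obtain ⟨y, hy, hzy⟩ := Set.mem_iUnion₂.1 (ht ⟨z, by simp [hz], rfl⟩)
  rw [mem_ball_iff_norm] at hzy
  rw [hST]
  change ‖T.1 z - U.starProjection (T.1 z)‖ ≤ _
  refine le_trans ?_ hzy.le
  rw [Submodule.starProjection_minimal]
  exact ciInf_le ⟨0, by rintro _ ⟨_, rfl⟩; exact norm_nonneg _⟩
    (⟨y, Submodule.subset_span hy⟩ : U)

/-- The projection onto a unit vector, as a minimal projection of `𝕂(H)`. -/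
def compactMinProjections (h : H) (hh : ‖h‖ = 1) :
    MinProjections PUnit.{1} (compactAlgebra H) where
  proj _ := theta H h h
  state _ :=
    { toFun := fun T => ⟪h, T.1 h⟫_ℂ
      map_add' := fun S T => by rw [← inner_add_right]; rfl
      map_smul' := fun c T => by rw [RingHom.id_apply, smul_eq_mul, ← inner_smul_right]; rfl }
  star_proj _ := star_theta h h
  norm_proj _ := by rw [norm_theta, hh, one_mul]
  proj_mul_self _ := by rw [theta_mul, inner_self_eq_norm_sq_to_K, hh]; simp
  proj_mul_mul _ T := theta_mul_mul h h h h T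
  proj_mul_mul_of_ne v v' hv := (hv (Subsingleton.elim v v')).elim
  state_star_mul_self _ T := ⟨‖T.1 h‖ ^ 2, by positivity, by
    change ⟪h, ContinuousLinearMap.adjoint T.1 (T.1 h)⟫_ℂ = _
    rw [ContinuousLinearMap.adjoint_inner_right, inner_self_eq_norm_sq_to_K]
    simp⟩
  dense_span := by
    refine dense_span_theta.mono (Submodule.span_mono ?_)
    rintro _ ⟨⟨x, y⟩, rfl⟩
    -- For a unit vector `h`, `θ_{x,h} θ_{h,h} θ_{h,y} = θ_{x,y}`.
    refine ⟨(PUnit.unit, theta H x h, theta H h y), ?_⟩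
    simp [theta_mul, inner_self_eq_norm_sq_to_K, hh]

end compact

/-! ### Minimal projections of c₀-sums -/

section c0

variable {V : Type*} {A : V → Type*} [∀ v, NonUnitalCStarAlgebra (A v)]

theorem c0Sum.ι_mul_ι (v : V) (a b : A v) :
    c0Sum.ι v a * c0Sum.ι v b = c0Sum.ι v (a * b) := by
  rw [c0Sum.ι_mul, c0Sum.eval_ι_self]

theorem c0Sum.continuous_ι (v : V) : Continuous (c0Sum.ι (A := A) v) :=
  ((c0Sum.ι (A := A) v).mkContinuous 1 fun a => by rw [c0Sum.norm_ι, one_mul]).continuous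

/-- The algebraic direct sum is dense in the `c₀`-sum. -/
theorem c0Sum.dense_span_ι :
    Dense (Submodule.span ℂ (Set.range fun p : Σ v, A v => c0Sum.ι p.1 p.2) :
      Set (c0Sum A)) := by
  classical
  intro f
  rw [Metric.mem_closure_iff]
  intro ε hε
  have hf : Tendsto (fun v => ‖f.1 v‖) cofinite (𝓝 0) := f.2
  -- Truncate `f` to the finitely many coordinates of norm at least `ε / 2`; the sup norm of the
  -- rest is at most `ε / 2`.
  have hfin := (Metric.tendsto_nhds.1 hf) (ε / 2) (by positivity)
  rw [Filter.eventually_cofinite] at hfin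
  refine ⟨∑ v ∈ hfin.toFinset, c0Sum.ι v (c0Sum.eval v f),
    Submodule.sum_mem _ fun v _ => Submodule.subset_span ⟨⟨v, _⟩, rfl⟩, ?_⟩
  rw [dist_eq_norm]
  refine lt_of_le_of_lt (b := ε / 2) ?_ (by linarith)
  refine lp.norm_le_of_forall_le (by positivity) fun v => ?_
  change ‖c0Sum.eval v (f - ∑ v ∈ hfin.toFinset, c0Sum.ι v (c0Sum.eval v f))‖ ≤ _
  rw [map_sub, map_sum]
  by_cases hv : v ∈ hfin.toFinset
  · rw [Finset.sum_eq_single_of_mem v hv fun j _ hj => c0Sum.eval_ι_ne hj.symm _,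
      c0Sum.eval_ι_self, sub_self, norm_zero]
    positivity
  · rw [Finset.sum_eq_zero fun j hj => c0Sum.eval_ι_ne
      (fun h => hv (by rw [h]; exact hj)) _, sub_zero]
    have : dist ‖f.1 v‖ 0 < ε / 2 := by simpa using hv
    rw [dist_zero_right, norm_norm] at this
    exact this.le

/-- Minimal projections of the summands of a `c₀`-sum. -/
def c0MinProjections (π : ∀ v, MinProjections PUnit.{1} (A v)) : MinProjections V (c0Sum A) where
  proj v := c0Sum.ι v ((π v).proj ⟨⟩)
  state v := ((π v).state ⟨⟩).comp (c0Sum.eval v)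
  star_proj v := by rw [c0Sum.star_ι, (π v).star_proj]
  norm_proj v := by rw [c0Sum.norm_ι, (π v).norm_proj]
  proj_mul_self v := by rw [c0Sum.ι_mul_ι, (π v).proj_mul_self]
  proj_mul_mul v a := by
    rw [c0Sum.ι_mul, c0Sum.ι_mul_ι, (π v).proj_mul_mul, map_smul]
    rfl
  proj_mul_mul_of_ne v v' h a := by
    rw [c0Sum.ι_mul, c0Sum.ι_mul, c0Sum.eval_ι_ne h, mul_zero, map_zero]
  state_star_mul_self v a := (π v).state_star_mul_self ⟨⟩ (c0Sum.eval v a)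
  dense_span := by
    intro f
    refine map_mem_of_dense_span (N := Submodule.topologicalClosure _) c0Sum.dense_span_ι
      (Submodule.isClosed_topologicalClosure _) LinearMap.id continuous_id ?_ f
    rintro _ ⟨⟨v, a⟩, rfl⟩
    refine map_mem_of_dense_span (π v).dense_span (Submodule.isClosed_topologicalClosure _)
      (c0Sum.ι v) (c0Sum.continuous_ι v) ?_ a
    rintro _ ⟨⟨_, a, a'⟩, rfl⟩
    refine Submodule.le_topologicalClosure _
      (Submodule.subset_span ⟨(v, c0Sum.ι v a, c0Sum.ι v a'), ?_⟩)
    simp only [c0Sum.ι_mul_ι]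

end c0

/-! ### Calculus in separated completions -/

namespace PreCorrespondence

variable {A B : Type*} {E : Type u} [NonUnitalCStarAlgebra A] [NonUnitalCStarAlgebra B]
  [AddCommGroup E] [Module ℂ E] (P : PreCorrespondence A B E)
  (h : Dense (Submodule.span ℂ {y | ∃ a x, y = P.toSpace (P.lact a x)} : Set P.Space))

/-- The canonical map into the correspondence obtained by separated completion. -/
def embed : E →ₗ[ℂ] (P.completion h).carrier := P.toCompl

theorem denseRange_embed : DenseRange (P.embed h) := P.denseRange_toCompl

theorem inner_embed (x y : E) :
    (P.completion h).pre.inner (P.embed h x) (P.embed h y) = P.inner x y := P.innerC_coe x y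

theorem lact_embed (a : A) (x : E) :
    (P.completion h).pre.lact a (P.embed h x) = P.embed h (P.lact a x) := P.lactC_coe a x

theorem ract_embed (b : B) (x : E) :
    (P.completion h).pre.ract b (P.embed h x) = P.embed h (P.ract b x) := P.ractC_coe b x

theorem norm_embed (x : E) : ‖P.embed h x‖ = ‖P.toSpace x‖ := P.norm_toCompl x

variable {P h} in
theorem dense_of_embed_mem {S : Set (P.completion h).carrier}
    (hS : ∀ x, P.embed h x ∈ (Submodule.span ℂ S).topologicalClosure) :
    Dense (Submodule.span ℂ S : Set (P.completion h).carrier) := fun x =>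
  (P.denseRange_embed h).induction_on (p := fun x => x ∈ (Submodule.span ℂ S).topologicalClosure) x
    (Submodule.isClosed_topologicalClosure _) hS

end PreCorrespondence

/-! ### Frames of direct sums -/

section sumFrame

variable {V W : Type*} {I : Type u} {A : V → Type*} {B : W → Type*}
  [∀ v, NonUnitalCStarAlgebra (A v)] [∀ w, NonUnitalCStarAlgebra (B w)] (s : I → V) (r : I → W)
  (F : ∀ e, Correspondence.{u} (A (s e)) (B (r e)))

open Classical in
theorem sumPre_lact_single (f : c0Sum A) (e : I) (y : (F e).carrier) :
    (sumPre s r F).lact f (DFinsupp.single e y) =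
      DFinsupp.single e ((F e).pre.lact (c0Sum.eval (s e) f) y) := by
  refine DFinsupp.ext fun e' => ?_
  rw [sumPre_lact_apply]
  by_cases h : e' = e
  · subst h
    rw [DFinsupp.single_eq_same, DFinsupp.single_eq_same]
  · rw [DFinsupp.single_eq_of_ne h, DFinsupp.single_eq_of_ne h, map_zero]

open Classical in
theorem sumPre_ract_single (g : c0Sum B) (e : I) (y : (F e).carrier) :
    (sumPre s r F).ract g (DFinsupp.single e y) =
      DFinsupp.single e ((F e).pre.ract (c0Sum.eval (r e) g) y) := by
  refine DFinsupp.ext fun e' => ?_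
  rw [sumPre_ract_apply]
  by_cases h : e' = e
  · subst h
    rw [DFinsupp.single_eq_same, DFinsupp.single_eq_same]
  · rw [DFinsupp.single_eq_of_ne h, DFinsupp.single_eq_of_ne h, map_zero]

open Classical in
theorem sumPre_inner_single (e : I) (y : (F e).carrier) (ξ : Π₀ e, (F e).carrier) :
    (sumPre s r F).inner (DFinsupp.single e y) ξ = c0Sum.ι (r e) ((F e).pre.inner y (ξ e)) := by
  change sumInner s r F _ _ = _
  rw [sumInner_eq s r F _ _ {e} (Or.inl DFinsupp.support_single_subset),
    Finset.sum_singleton, DFinsupp.single_eq_same]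

open Classical in
/-- The inclusion of a summand. -/
def sumVec (e : I) : (F e).carrier →ₗ[ℂ] (sumCorr s r F).carrier :=
  ((sumPre s r F).embed (sumPre_nondegenerate s r F)).comp
    (DFinsupp.lsingle (R := ℂ) (M := fun e => (F e).carrier) e)

open Classical in
theorem sumVec_apply (e : I) (y : (F e).carrier) : sumVec s r F e y =
    (sumPre s r F).embed (sumPre_nondegenerate s r F) (DFinsupp.single e y) := rfl

theorem continuous_sumVec (e : I) : Continuous (sumVec s r F e) :=
  ((sumVec s r F e).mkContinuous 1 fun y => by
    rw [one_mul]
    exact ((sumPre s r F).norm_embed _ _).trans_le (norm_toSpace_single_le s r F e y)).continuous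

theorem lact_sumVec (f : c0Sum A) (e : I) (y : (F e).carrier) :
    (sumCorr s r F).pre.lact f (sumVec s r F e y) =
      sumVec s r F e ((F e).pre.lact (c0Sum.eval (s e) f) y) :=
  ((sumPre s r F).lact_embed _ _ _).trans (congrArg _ (sumPre_lact_single s r F f e y))

theorem ract_sumVec (g : c0Sum B) (e : I) (y : (F e).carrier) :
    (sumCorr s r F).pre.ract g (sumVec s r F e y) =
      sumVec s r F e ((F e).pre.ract (c0Sum.eval (r e) g) y) :=
  ((sumPre s r F).ract_embed _ _ _).trans (congrArg _ (sumPre_ract_single s r F g e y))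

theorem inner_sumVec (e : I) (y z : (F e).carrier) :
    (sumCorr s r F).pre.inner (sumVec s r F e y) (sumVec s r F e z) =
      c0Sum.ι (r e) ((F e).pre.inner y z) := by
  classical
  rw [sumVec_apply, sumVec_apply]
  refine ((sumPre s r F).inner_embed _ _ _).trans ((sumPre_inner_single s r F e y _).trans ?_)
  rw [DFinsupp.single_eq_same]

theorem inner_sumVec_of_ne {e e' : I} (h : e ≠ e') (y : (F e).carrier) (z : (F e').carrier) :
    (sumCorr s r F).pre.inner (sumVec s r F e y) (sumVec s r F e' z) = 0 := by
  classical
  rw [sumVec_apply, sumVec_apply]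
  refine ((sumPre s r F).inner_embed _ _ _).trans ((sumPre_inner_single s r F e y _).trans ?_)
  rw [DFinsupp.single_eq_of_ne h, map_zero, map_zero]

variable {s r F}

/-- If each summand is generated by a single frame vector, these vectors are a frame of the direct
sum. -/
theorem isFrame_sumCorr {π : ∀ v, MinProjections PUnit.{1} (A v)}
    {ρ : ∀ w, MinProjections PUnit.{1} (B w)} {x : ∀ e, (F e).carrier}
    (hx : ∀ e, IsFrame (π (s e)) (ρ (r e)) (F e) (fun _ : PUnit.{1} => ⟨⟩) (fun _ => ⟨⟩)
      fun _ => x e) :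
    IsFrame (c0MinProjections π) (c0MinProjections ρ) (sumCorr s r F) s r
      fun e => sumVec s r F e (x e) where
  lact_proj e := by
    rw [lact_sumVec]
    refine congrArg _ (Eq.trans ?_ ((hx e).lact_proj ⟨⟩))
    exact congrArg (fun a => (F e).pre.lact a (x e)) (c0Sum.eval_ι_self _ _)
  inner_self e := by
    rw [inner_sumVec]
    exact congrArg _ ((hx e).inner_self ⟨⟩)
  inner_of_ne e e' h := inner_sumVec_of_ne s r F h _ _
  dense_span := by
    classical
    refine PreCorrespondence.dense_of_embed_mem fun ξ => ?_
    induction ξ using DFinsupp.induction with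
    | h0 => rw [map_zero]; exact Submodule.zero_mem _
    | ha e y ξ _ _ hξ =>
      rw [map_add]
      refine Submodule.add_mem _ ?_ hξ
      change sumVec s r F e y ∈
        (Submodule.span ℂ (Set.range fun p : I × c0Sum A × c0Sum B =>
          (sumCorr s r F).pre.ract p.2.2 ((sumCorr s r F).pre.lact p.2.1
            (sumVec s r F p.1 (x p.1))))).topologicalClosure
      refine map_mem_of_dense_span (hx e).dense_span
        (Submodule.isClosed_topologicalClosure _) (sumVec s r F e) (continuous_sumVec s r F e) ?_ y
      rintro _ ⟨⟨_, a, g⟩, rfl⟩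
      refine Submodule.le_topologicalClosure _
        (Submodule.subset_span ⟨(e, c0Sum.ι (s e) a, c0Sum.ι (r e) g), ?_⟩)
      simp only [lact_sumVec, ract_sumVec, c0Sum.eval_ι_self]

end sumFrame

/-! ### Frames of interior tensor products -/

section tensorFrame

variable {A B C : Type*} [NonUnitalCStarAlgebra A] [NonUnitalCStarAlgebra B]
  [NonUnitalCStarAlgebra C]

namespace Correspondence

variable (X : Correspondence.{u} A B) (Y : Correspondence.{u} B C)

/-- The elementary tensors as a bilinear map. -/
def tmulₗ : X.carrier →ₗ[ℂ] Y.carrier →ₗ[ℂ] (X.tensor Y).carrier :=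
  (TensorProduct.mk ℂ X.carrier Y.carrier).compr₂ (X.pre.tensor Y.pre).toCompl

theorem lact_tmul (a : A) (ξ : X.carrier) (η : Y.carrier) :
    (X.tensor Y).pre.lact a (X.tmulₗ Y ξ η) = X.tmulₗ Y (X.pre.lact a ξ) η :=
  (X.pre.tensor Y.pre).lact_embed _ a (ξ ⊗ₜ η)

theorem ract_tmul (c : C) (ξ : X.carrier) (η : Y.carrier) :
    (X.tensor Y).pre.ract c (X.tmulₗ Y ξ η) = X.tmulₗ Y ξ (Y.pre.ract c η) :=
  (X.pre.tensor Y.pre).ract_embed _ c (ξ ⊗ₜ η)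

theorem inner_tmul (ξ ξ' : X.carrier) (η η' : Y.carrier) :
    (X.tensor Y).pre.inner (X.tmulₗ Y ξ η) (X.tmulₗ Y ξ' η') =
      Y.pre.inner η (Y.pre.lact (X.pre.inner ξ ξ') η') :=
  (X.pre.tensor Y.pre).inner_embed _ (ξ ⊗ₜ η) (ξ' ⊗ₜ η')

theorem tmulₗ_balanced (ξ : X.carrier) (b : B) (η : Y.carrier) :
    X.tmulₗ Y (X.pre.ract b ξ) η = X.tmulₗ Y ξ (Y.pre.lact b η) := X.tmul_balanced Y ξ b η

theorem norm_tmul_le (ξ : X.carrier) (η : Y.carrier) : ‖X.tmulₗ Y ξ η‖ ≤ ‖ξ‖ * ‖η‖ :=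
  ((X.pre.tensor Y.pre).norm_embed _ (ξ ⊗ₜ η)).trans_le (norm_toSpace_tmul_le X Y ξ η)

theorem continuous_tmul_left (η : Y.carrier) : Continuous ((X.tmulₗ Y).flip η) :=
  (((X.tmulₗ Y).flip η).mkContinuous ‖η‖ fun ξ => by
    rw [mul_comm]; exact X.norm_tmul_le Y ξ η).continuous

theorem continuous_tmul_right (ξ : X.carrier) : Continuous (X.tmulₗ Y ξ) :=
  ((X.tmulₗ Y ξ).mkContinuous ‖ξ‖ (X.norm_tmul_le Y ξ)).continuous

variable {X Y}

theorem dense_of_tmul_mem {S : Set (X.tensor Y).carrier}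
    (hS : ∀ ξ η, X.tmulₗ Y ξ η ∈ (Submodule.span ℂ S).topologicalClosure) :
    Dense (Submodule.span ℂ S : Set (X.tensor Y).carrier) := by
  refine PreCorrespondence.dense_of_embed_mem fun x => ?_
  induction x with
  | zero => rw [map_zero]; exact Submodule.zero_mem _
  | add x y hx hy => rw [map_add]; exact Submodule.add_mem _ hx hy
  | tmul ξ η => exact hS ξ η

end Correspondence

variable {U V W : Type*} {π : MinProjections U A} {ρ : MinProjections V B}
  {σ : MinProjections W C} {X : Correspondence.{u} A B} {Y : Correspondence.{u} B C}
  {I J : Type u} {s : I → U} {r : I → V} {s' : J → V} {r' : J → W}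
  {b : I → X.carrier} {c : J → Y.carrier}

/-- The elementary tensors of frame vectors along the paths of length two are a frame of the
interior tensor product. -/
theorem IsFrame.tensor (hb : IsFrame π ρ X s r b) (hc : IsFrame ρ σ Y s' r' c) :
    IsFrame π σ (X.tensor Y) (fun p : {p : I × J // r p.1 = s' p.2} => s p.1.1)
      (fun p => r' p.1.2) (fun p => X.tmulₗ Y (b p.1.1) (c p.1.2)) where
  lact_proj p := by rw [X.lact_tmul, hb.lact_proj]
  -- The inner square is `⟨c, q c⟩` with `q` the projection at the target of the first edge; it
  -- fixes `c` because the second edge starts there.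
  inner_self p := by rw [X.inner_tmul, hb.inner_self, p.2, hc.lact_proj, hc.inner_self]
  inner_of_ne := by
    rintro ⟨⟨e, f⟩, h⟩ ⟨⟨e', f'⟩, h'⟩ hne
    rw [X.inner_tmul]
    by_cases he : e = e'
    · subst he
      exact hc.inner_lact_of_ne _ fun hf => hne (by subst hf; rfl)
    · rw [hb.inner_of_ne e e' he, map_zero, LinearMap.zero_apply, map_zero]
  dense_span := by
    refine Correspondence.dense_of_tmul_mem fun ξ η => ?_
    refine map_mem_of_dense_span hb.dense_span (Submodule.isClosed_topologicalClosure _)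
      ((X.tmulₗ Y).flip η) (X.continuous_tmul_left Y η) ?_ ξ
    rintro _ ⟨⟨e, a, g⟩, rfl⟩
    refine map_mem_of_dense_span hc.dense_span (Submodule.isClosed_topologicalClosure _)
      (X.tmulₗ Y _) (X.continuous_tmul_right Y _) ?_ η
    rintro _ ⟨⟨f, g', k⟩, rfl⟩
    refine Submodule.le_topologicalClosure _ ?_
    -- Move `g` across the balanced tensor and insert `q = ρ.proj (r e)`, which fixes `b e` on the
    -- right. The factor `q g g' c_f` is then a multiple of `c_f` if the edges compose, and zero
    -- otherwise.
    have h1 : X.tmulₗ Y (X.pre.ract g (X.pre.lact a (b e))) (Y.pre.ract k (Y.pre.lact g' (c f))) =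
        (X.tensor Y).pre.ract k ((X.tensor Y).pre.lact a (X.tmulₗ Y (b e)
          (Y.pre.lact (ρ.proj (r e)) (Y.pre.lact (g * g') (c f))))) := by
      rw [← X.lact_ract, ← X.ract_tmul, ← X.lact_tmul, Y.pre.lact_mul,
        ← X.tmulₗ_balanced Y (b e) (ρ.proj (r e)), hb.ract_proj, ← X.tmulₗ_balanced Y (b e) g]
    rw [h1]
    by_cases h : r e = s' f
    · rw [h, hc.proj_lact, map_smul, map_smul, map_smul]
      exact Submodule.smul_mem _ _ (Submodule.subset_span ⟨(⟨(e, f), h⟩, a, k), rfl⟩)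
    · rw [hc.proj_lact_of_ne _ (Ne.symm h), map_zero, map_zero, map_zero]
      exact Submodule.zero_mem _

end tensorFrame

/-! ### Counting paths and edges -/

/-- Paths of length two are sorted by their middle vertex. -/
theorem edgeCard_paths {U W : Type*} {V I J : Type u} (s : I → U) (r : I → V) (s' : J → V)
    (r' : J → W) (u : U) (w : W) :
    edgeCard (fun p : {p : I × J // r p.1 = s' p.2} => s p.1.1) (fun p => r' p.1.2) u w =
      Cardinal.sum fun v => edgeCard s r u v * edgeCard s' r' v w := by
  simp only [edgeCard, Cardinal.mul_def]
  rw [← Cardinal.mk_sigma, Cardinal.eq]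
  exact ⟨{
    toFun := fun p => ⟨r p.1.1.1, ⟨p.1.1.1, p.2.1, rfl⟩, ⟨p.1.1.2, p.1.2.symm, p.2.2⟩⟩
    invFun := fun q => ⟨⟨(q.2.1.1, q.2.2.1), q.2.1.2.2.trans q.2.2.2.1.symm⟩,
      q.2.1.2.1, q.2.2.2.2⟩
    left_inv := fun _ => rfl
    right_inv := by rintro ⟨_, ⟨e, rfl, rfl⟩, ⟨f, h, rfl⟩⟩; rfl }⟩

theorem edgeCard_edge {V W : Type u} (C : Matrix V W Cardinal.{u}) (v : V) (w : W) :
    edgeCard (Edge.src (C := C)) Edge.tgt v w = C v w := by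
  rw [edgeCard, ← Cardinal.mk_ord_toType (C v w), Cardinal.eq]
  exact ⟨{
    -- The index has a type depending on the endpoints of the edge, so it is transported along the
    -- equalities of endpoints.
    toFun := fun e => cast (by obtain ⟨e, rfl, rfl⟩ := e; rfl) e.1.idx
    invFun := fun α => ⟨⟨v, w, α⟩, rfl, rfl⟩
    left_inv := by rintro ⟨e, rfl, rfl⟩; rfl
    right_inv := fun _ => rfl }⟩

/-! ### The standard frame of `X(C)` -/

section std

/-- The single vector `h ⊗ k` suffices: `θ_{ξ,h} h = ξ` on the left and `k · θ_{k,y} = θ_{y,k} k =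
y` on the right, so every elementary tensor is `a · (h ⊗ k) · g`. -/
theorem isFrame_stdBimodule {H' H : Type u} [NormedAddCommGroup H'] [InnerProductSpace ℂ H']
    [CompleteSpace H'] [NormedAddCommGroup H] [InnerProductSpace ℂ H] [CompleteSpace H]
    {h : H'} (hh : ‖h‖ = 1) {k : H} (hk : ‖k‖ = 1) :
    IsFrame (compactMinProjections h hh) (compactMinProjections k hk) (stdBimodule H' H)
      (fun _ : PUnit.{1} => ⟨⟩) (fun _ => ⟨⟩)
      fun _ => (stdLeft H').tmulₗ (stdRight H) h (toConj H k) := by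
  have hθ : ∀ {K : Type u} [NormedAddCommGroup K] [InnerProductSpace ℂ K] [CompleteSpace K]
      {x : K} (_ : ‖x‖ = 1) (y : K), (theta K y x).1 x = y := by
    intro K _ _ _ x hx y
    change InnerProductSpace.rankOne ℂ y x x = y
    rw [InnerProductSpace.rankOne_apply, inner_self_eq_norm_sq_to_K, hx]
    simp
  have hl : ∀ y : H', (stdLeft H').pre.lact (theta H' y h) h = y := hθ hh
  have hr : ∀ y : H, (stdRight H).pre.ract (theta H k y) (toConj H k) = toConj H y := by
    intro y
    rw [stdRight_ract_theta, hθ hk]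
  refine ⟨fun _ => ?_, fun _ => ?_, fun e e' he => (he (Subsingleton.elim e e')).elim, ?_⟩
  · refine ((stdLeft H').lact_tmul (stdRight H) _ _ _).trans ?_
    exact congrArg (fun x => (stdLeft H').tmulₗ (stdRight H) x (toConj H k)) (hl h)
  · refine ((stdLeft H').inner_tmul (stdRight H) _ _ _ _).trans ?_
    have h1 : (stdLeft H').pre.inner h h = 1 := by
      change ⟪h, h⟫_ℂ = 1
      rw [inner_self_eq_norm_sq_to_K, hh]; simp
    rw [h1]
    have h2 : (stdRight H).pre.lact 1 (toConj H k) = toConj H k := one_smul ℂ (toConj H k)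
    rw [h2]
    rfl
  · refine Correspondence.dense_of_tmul_mem (X := stdLeft H') (Y := stdRight H) fun ξ η =>
      Submodule.le_topologicalClosure _ (Submodule.subset_span
        ⟨(⟨⟩, theta H' ξ h, theta H k ((toConj H).symm η)), ?_⟩)
    refine (congrArg _ ((stdLeft H').lact_tmul (stdRight H) _ _ _)).trans ?_
    refine ((stdLeft H').ract_tmul (stdRight H) _ _ _).trans ?_
    exact congrArg₂ (fun x y => (stdLeft H').tmulₗ (stdRight H) x y) (hl ξ) (hr _)

variable {V W : Type u} {HV : V → Type u} {HW : W → Type u}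
    [∀ v, NormedAddCommGroup (HV v)] [∀ v, InnerProductSpace ℂ (HV v)]
    [∀ v, CompleteSpace (HV v)]
    [∀ w, NormedAddCommGroup (HW w)] [∀ w, InnerProductSpace ℂ (HW w)]
    [∀ w, CompleteSpace (HW w)]

/-- The minimal projections of `⊕_v 𝕂(H_v)` onto the lines spanned by unit vectors `h_v`. -/
def compactSumMinProjections (h : ∀ v, HV v) (hh : ∀ v, ‖h v‖ = 1) :
    MinProjections V (compactSum HV) :=
  c0MinProjections fun v => compactMinProjections (h v) (hh v)

theorem exists_isFrame_graphCorr {h : ∀ v, HV v} (hh : ∀ v, ‖h v‖ = 1) {k : ∀ w, HW w}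
    (hk : ∀ w, ‖k w‖ = 1) (C : Matrix V W Cardinal.{u}) :
    ∃ b, IsFrame (compactSumMinProjections h hh) (compactSumMinProjections k hk)
      (graphCorr HV HW C) (Edge.src (C := C)) Edge.tgt b :=
  ⟨_, isFrame_sumCorr fun e => isFrame_stdBimodule (hh e.src) (hk e.tgt)⟩

end std

/-! ### Classification by edge numbers -/

/-- A correspondence with a frame is isomorphic to `X(C)` if and only if `C` counts the edges of
that frame. -/
theorem isomorphic_graphCorr_iff {V W : Type u} {HV : V → Type u} {HW : W → Type u}
    [∀ v, NormedAddCommGroup (HV v)] [∀ v, InnerProductSpace ℂ (HV v)]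
    [∀ v, CompleteSpace (HV v)]
    [∀ w, NormedAddCommGroup (HW w)] [∀ w, InnerProductSpace ℂ (HW w)]
    [∀ w, CompleteSpace (HW w)] {h : ∀ v, HV v} (hh : ∀ v, ‖h v‖ = 1) {k : ∀ w, HW w}
    (hk : ∀ w, ‖k w‖ = 1) (X : Correspondence.{u} (compactSum HV) (compactSum HW))
    {I : Type u} {s : I → V} {r : I → W} {b : I → X.carrier}
    (hb : IsFrame (compactSumMinProjections h hh) (compactSumMinProjections k hk) X s r b)
    (C : Matrix V W Cardinal.{u}) :
    X.Isomorphic (graphCorr HV HW C) ↔ ∀ v w, edgeCard s r v w = C v w := by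
  obtain ⟨c, hc⟩ := exists_isFrame_graphCorr hh hk C
  constructor
  · intro hX v w
    -- The standard frame is pulled back to `X`, where its edge numbers must agree with those of the
    -- given frame.
    obtain ⟨c', hc'⟩ := hc.of_isomorphic hX.symm
    rw [hb.edgeCard_eq hc' v w, edgeCard_edge]
  · intro hC
    refine hb.isomorphic_of_edgeCard hc fun v w => ?_
    rw [hC, edgeCard_edge]

end CStarCorr

end

theorem mainTheorem5 {U V W : Type u} (HU : U → Type u) (HV : V → Type u) (HW : W → Type u)
    [∀ i, NormedAddCommGroup (HU i)] [∀ i, InnerProductSpace ℂ (HU i)]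
    [∀ i, CompleteSpace (HU i)] [∀ i, Nontrivial (HU i)]
    [∀ i, NormedAddCommGroup (HV i)] [∀ i, InnerProductSpace ℂ (HV i)]
    [∀ i, CompleteSpace (HV i)] [∀ i, Nontrivial (HV i)]
    [∀ i, NormedAddCommGroup (HW i)] [∀ i, InnerProductSpace ℂ (HW i)]
    [∀ i, CompleteSpace (HW i)] [∀ i, Nontrivial (HW i)] :
    (∀ X : CStarCorr.Correspondence.{u} (CStarCorr.compactSum HV) (CStarCorr.compactSum HW),
      ∃! C : Matrix V W Cardinal.{u}, X.Isomorphic (CStarCorr.graphCorr HV HW C)) ∧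
    (∀ (C : Matrix U V Cardinal.{u}) (D : Matrix V W Cardinal.{u}),
      ((CStarCorr.graphCorr HU HV C).tensor (CStarCorr.graphCorr HV HW D)).Isomorphic
        (CStarCorr.graphCorr HU HW (CStarCorr.cardMul C D))) := by
  -- Non-zero spaces contain unit vectors; these fix the minimal projections for both parts.
  choose hU hU1 using fun i => exists_norm_eq (HU i) zero_le_one
  choose hV hV1 using fun i => exists_norm_eq (HV i) zero_le_one
  choose hW hW1 using fun i => exists_norm_eq (HW i) zero_le_one
  refine ⟨fun X => ?_, fun C D => ?_⟩
  · obtain ⟨I, s, r, b, hb⟩ := CStarCorr.exists_isFrame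
      (CStarCorr.compactSumMinProjections hV hV1) (CStarCorr.compactSumMinProjections hW hW1) X
    have hiff := CStarCorr.isomorphic_graphCorr_iff hV1 hW1 X hb
    refine ⟨CStarCorr.edgeCard s r, (hiff _).2 fun _ _ => rfl, fun C hC => ?_⟩
    exact funext₂ fun v w => ((hiff C).1 hC v w).symm
  · obtain ⟨b, hb⟩ := CStarCorr.exists_isFrame_graphCorr hU1 hV1 C
    obtain ⟨c, hc⟩ := CStarCorr.exists_isFrame_graphCorr hV1 hW1 D
    -- The frame of composable pairs reduces the isomorphism to an identity of cardinals: paths from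
    -- `u` to `w` against the entry of the matrix product.
    refine (CStarCorr.isomorphic_graphCorr_iff hU1 hW1 _ (hb.tensor hc) _).2 fun u w => ?_
    rw [CStarCorr.edgeCard_paths]
    simp only [CStarCorr.edgeCard_edge]
    rfl
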